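/- Let $\log x$ denote the natural logarithm and let $\log^{(0)}x:=x$ and $\log^{(i)}x:=\log(\log^{(i-1)}x)$ for integers $i\ge 1$. All graphs are finite, simple and undirected. For an integer $\ell\ge 1$, an $\ell$-ranking of a graph $G$ is a map $\varphi:V(G)\to\mathbb{N}$ such that for every path $u_0,\ldots,u_p$ in $G$ with $1\le p\le \ell$ edges, $\varphi(u_0)\neq\varphi(u_p)$ or $\varphi(u_0)<\max\{\varphi(u_0),\ldots,\varphi(u_p)\}$. The $\ell$-ranking number $\chi_\ell(G)$ is the minimum $k$ such that $G$ has an $\ell$-ranking with all colours in $\{1,\ldots,k\}$. A tree decomposition of $G$ is a family $(B_x:x\in V(T))$ of subsets (bags) of $V(G)$ indexed by the nodes of a tree $T$ such that for each $v\in V(G)$ the nodes $x$ with $v\in B_x$ induce a non-empty connected subgraph of $T$, and each edge of $G$ has both endpoints in some bag; its width is $\max_x|B_x|-1$. It is $t$-simple if it has width $t$ and, for every $t$-element set $S\subseteq V(G)$, there are at most two nodes $x$ with $S\subseteq B_x$. The simple treewidth of $G$ is the minimum $t$ such that $G$ has a $t$-simple tree decomposition. **Theorem.** (Upper bound.) For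 all integers $\ell\ge 2$ and $t\ge 1$ there are constants $C$ and $N$, depending only on $\ell$ and $t$, such that for every $n\ge N$, every $n$-vertex graph $H$ of simple treewidth at most $t$ satisfies $$\chi_\ell(H)\le C\cdot\frac{\log n}{\log^{(t)}n}.$$ (Lower bound.) For every integer $t\ge 1$ there is a constant $c>0$, depending only on $t$, such that for infinitely many $n$ there is an $n$-vertex graph $H$ of simple treewidth exactly $t$ with $$\chi_2(H)\ge c\cdot\frac{\log n}{\log^{(t)}n}.$$ -/

import Mathlib

/-- The `i`-fold iterated natural logarithm: `log^(0) x = x` and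
`log^(i+1) x = log (log^(i) x)`. It has its usual meaning for all sufficiently large `x`. -/
noncomputable def iteratedLog : ℕ → ℝ → ℝ
  | 0, x => x
  | i + 1, x => Real.log (iteratedLog i x)

namespace SimpleGraph

/-- `φ` is an `ℓ`-ranking of `G`: for every non-trivial path `u = u₀, …, u_p = v` with at most `ℓ`
edges, `φ u ≠ φ v` or `φ u < max {φ u₀, …, φ u_p}`. -/
def IsRanking {V : Type*} (G : SimpleGraph V) (ℓ : ℕ) (φ : V → ℕ) : Prop :=
  ∀ (u v : V) (p : G.Walk u v), p.IsPath → 1 ≤ p.length → p.length ≤ ℓ →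
    φ u ≠ φ v ∨ ∃ w ∈ p.support, φ u < φ w

/-- The `ℓ`-ranking number `χ_ℓ(G)`: the least `k` such that `G` has an `ℓ`-ranking with colours
in `{1, …, k}`. -/
noncomputable def rankingNumber {V : Type*} (G : SimpleGraph V) (ℓ : ℕ) : ℕ :=
  sInf {k : ℕ | ∃ φ : V → ℕ, G.IsRanking ℓ φ ∧ ∀ v, φ v ∈ Finset.Icc 1 k}

/-- A tree decomposition of `G` whose tree has node set `ι`. -/
structure TreeDecomposition {V : Type*} (G : SimpleGraph V) (ι : Type*) where
  /-- the tree -/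
  tree : SimpleGraph ι
  isTree : tree.IsTree
  /-- the bags -/
  bag : ι → Finset V
  connected : ∀ v : V, (tree.induce {x | v ∈ bag x}).Connected
  edge_mem : ∀ v w : V, G.Adj v w → ∃ x, v ∈ bag x ∧ w ∈ bag x

/-- The width of a tree decomposition: the maximum size of a bag, minus one (as an integer). -/
def TreeDecomposition.width {V ι : Type*} [Fintype ι] {G : SimpleGraph V}
    (D : G.TreeDecomposition ι) : ℤ :=
  ((Finset.univ.sup fun x => (D.bag x).card : ℕ) : ℤ) - 1

/-- A tree decomposition is `t`-simple if it has width `t` and every set of exactly `t` vertices is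
contained in at most two bags (counted by their nodes). -/
def TreeDecomposition.IsSimple {V ι : Type*} [Fintype ι] {G : SimpleGraph V}
    (D : G.TreeDecomposition ι) (t : ℕ) : Prop :=
  D.width = (t : ℤ) ∧ ∀ S : Finset V, S.card = t → {x | S ⊆ D.bag x}.ncard ≤ 2

/-- `G` has a `t`-simple tree decomposition (over some finite tree). -/
def HasSimpleTreeDecomposition {V : Type*} (G : SimpleGraph V) (t : ℕ) : Prop :=
  ∃ (ι : Type) (_ : Fintype ι) (D : G.TreeDecomposition ι), D.IsSimple t

/-- The simple treewidth of `G`: the least `t` such that `G` has a `t`-simple tree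
decomposition. -/
noncomputable def simpleTreewidth {V : Type*} (G : SimpleGraph V) : ℕ :=
  sInf {t : ℕ | G.HasSimpleTreeDecomposition t}

/-- The minimum that defines `rankingNumber` is over a non-empty set for every finite graph. -/
theorem exists_ranking {V : Type*} [Fintype V] (G : SimpleGraph V) (ℓ : ℕ) :
    {k : ℕ | ∃ φ : V → ℕ, G.IsRanking ℓ φ ∧ ∀ v, φ v ∈ Finset.Icc 1 k}.Nonempty := by
  refine ⟨Fintype.card V, fun v => (Fintype.equivFin V v : ℕ) + 1, ?_, ?_⟩
  · intro u v p hp h1 _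
    left
    intro h
    have huv : u = v := by
      apply (Fintype.equivFin V).injective
      apply Fin.ext
      simpa using h
    subst huv
    have hnil : p.length = 0 := Walk.length_eq_zero_iff.2 (Walk.isPath_iff_nil.1 hp)
    omega
  · intro v
    simp only [Finset.mem_Icc]
    have := (Fintype.equivFin V v).2
    omega

/-- The minimum that defines `simpleTreewidth` is over a non-empty set for every non-empty finite
graph. -/
theorem exists_simpleTreeDecomposition {V : Type*} [Fintype V] [Nonempty V] (G : SimpleGraph V) :
    {t : ℕ | G.HasSimpleTreeDecomposition t}.Nonempty := by
  refine ⟨Fintype.card V - 1, Unit, inferInstance, ⟨⊥, IsTree.of_subsingleton,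
    fun _ => Finset.univ, ?_, ?_⟩, ?_, ?_⟩
  · intro v
    have : Nonempty {x : Unit | v ∈ (Finset.univ : Finset V)} := ⟨⟨(), by simp⟩⟩
    exact Connected.mk (Preconnected.of_subsingleton)
  · intro v w _
    exact ⟨(), by simp, by simp⟩
  · have := Fintype.card_pos (α := V)
    simp [TreeDecomposition.width]
    omega
  · intro S _
    exact (Set.ncard_le_one_of_subsingleton _).trans one_le_two

end SimpleGraph

/-!
Both bounds come from induction on `t`: a structure of one more unit of width consists of about
`log n / log m` levels, each of which costs as many colours as a structure of smaller width and
size `m`, where `m` is roughly a power of `log n`.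

**Upper bound.** Rooting the tree of a tree decomposition turns the graph into a subgraph of a chordal
graph whose vertices form a rooted forest and whose edges join ancestors with descendants
(`ElimForest`). In such a graph the adjacent ancestors of a vertex form a clique, so a walk between
two vertices of a set `U` that is closed under adjacent ancestors can be shortened to a walk inside
`U` (`Joined.shortcut`). Breadth-first layers reduce the width by one and stay simple
(`IsLayering.widthLE`, `IsLayering.isSimple`); simplicity matters only at width one, where it leaves
paths, which need `O(1)` colours.

The induction on the width measures a forest by its number `k` of leaves instead of its number of
vertices and shows that `O(log k / log^(t) k)` colours suffice (`exists_isRank_iteratedLog`). The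
vertices are split into `log k / log K` classes by the logarithm to base `K ≈ √(log k)` of the number
of leaves below them. A class falls into trees with fewer than `K` leaves, and a walk whose ends are
in the highest class that it meets can be shortened to this class (`Joined.shortcut_level`). Hence
the classes could have disjoint palettes. To use the better bound of smaller width in them, only the
`ℓ + 2` layers directly below the higher classes of each class get palettes of this kind. A vertex
deeper down does not see the higher classes within distance `ℓ`, so the deep vertices of all classes
share one palette of size `O(log K)`, for which the crude bound `exists_isRank_log` suffices. The at
most `(K - 1) t` vertices per component on the border between shallow and deep get distinct top
colours. This is `exists_isRank_step`; with `f` colours for `K` leaves in width one lower, the total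
is `(log k / log K) (ℓ + 2) f + O(K)`, which is `exists_step_bound`.

**Lower bound.** Let `Q` be a graph of simple treewidth `t` with `m` vertices and `χ = χ₂(Q)`. Join a
new apex to `k + 1` disjoint copies of `Q`, and let every vertex of these copies be the root of a
graph `G` of simple treewidth `t + 1` (`BagTree.cone`); this keeps the simple treewidth `t + 1`. If
all 2-rankings of `G` with `k` colours give the root of `G` a colour above `M`, then each copy of `Q`
has a vertex of colour at least `M + χ`; two copies agree in this colour, so the apex between them has
a higher one (`BagTree.lt_apex`). With `k = m ^ 2` and `m ^ 2 / χ + 1` iterations `m ^ 2` colours are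
needed, and the number `n` of vertices satisfies `log n = O((m ^ 2 / χ) log m)`, which turns the
bound for `χ` into the next one (`exists_cone_bound`). The graphs contain a clique on `t + 2` vertices,
which has to lie in a bag, so their simple treewidth is exact (`BagTree.simpleTreewidth_eq`).
-/

open Filter

/-! ### Forest-ordered chordal graphs -/

/-- A chordal graph presented by a forest order: `V` is partially ordered so that the elements below
any vertex form a chain (`u ≤ v` means that `u` is an ancestor of `v`), and `E u v` says that `u` and
`v` are adjacent and `u` is the ancestor. The vertices `v` with `E u v` are, together with `u`, a
subtree rooted at `u`. -/
structure ElimForest (V : Type*) [PartialOrder V] where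
  /-- adjacency of an ancestor with a descendant -/
  E : V → V → Prop
  comparable : ∀ {u v w : V}, u ≤ w → v ≤ w → u ≤ v ∨ v ≤ u
  lt_of_E : ∀ {u v : V}, E u v → u < v
  E_of_E : ∀ {u v w : V}, E u v → u < w → w ≤ v → E u w

namespace ElimForest

open Classical in
/-- The part of `A` on which `f` has the value `i`. -/
noncomputable def level {V : Type*} (A : Finset V) (f : V → ℕ) (i : ℕ) : Finset V :=
  A.filter fun v => f v = i

@[simp] theorem mem_level {V : Type*} {A : Finset V} {f : V → ℕ} {i : ℕ} {v : V} :
    v ∈ level A f i ↔ v ∈ A ∧ f v = i := by simp [level]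

theorem level_subset {V : Type*} (A : Finset V) (f : V → ℕ) (i : ℕ) : level A f i ⊆ A :=
  fun _ h => (mem_level.1 h).1

variable {V : Type*} [PartialOrder V] (F : ElimForest V)

/-- Adjacency in the chordal graph. -/
def Adj (u v : V) : Prop := F.E u v ∨ F.E v u

/-- `F.Joined S n u v`: some walk with at most `n` edges leads from `u` to `v` inside `S`. -/
inductive Joined (S : Set V) : ℕ → V → V → Prop
  | refl {u : V} (n : ℕ) (hu : u ∈ S) : Joined S n u u
  | step {n : ℕ} {u w v : V} (hu : u ∈ S) (h : F.Adj u w) (hw : Joined S n w v) :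
      Joined S (n + 1) u v

/-- `φ` restricted to `A` is an `ℓ`-ranking: two vertices of the same colour `c` are not joined by
a walk of length at most `ℓ` on which `c` is the maximum colour. -/
def IsRank (ℓ : ℕ) (A : Finset V) (φ : V → ℕ) : Prop :=
  ∀ u ∈ A, ∀ v ∈ A, φ u = φ v → F.Joined {x | x ∈ A ∧ φ x ≤ φ u} ℓ u v → u = v

variable {F}

theorem Adj.symm {u v : V} (h : F.Adj u v) : F.Adj v u := Or.symm h

theorem Adj.comparable {u v : V} (h : F.Adj u v) : u ≤ v ∨ v ≤ u :=
  h.imp (fun h => (F.lt_of_E h).le) (fun h => (F.lt_of_E h).le)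

/-- The ancestors adjacent to a vertex form a clique. -/
theorem E_clique {u v m : V} (hu : F.E u m) (hv : F.E v m) : u = v ∨ F.Adj u v := by
  rcases F.comparable (F.lt_of_E hu).le (F.lt_of_E hv).le with h | h
  · rcases h.eq_or_lt with h | h
    · exact .inl h
    · exact .inr (.inl (F.E_of_E hu h (F.lt_of_E hv).le))
  · rcases h.eq_or_lt with h | h
    · exact .inl h.symm
    · exact .inr (.inr (F.E_of_E hv h (F.lt_of_E hu).le))

namespace Joined

variable {S T : Set V} {n : ℕ} {u v : V}

theorem left_mem (h : F.Joined S n u v) : u ∈ S := by cases h <;> assumption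

theorem right_mem (h : F.Joined S n u v) : v ∈ S := by
  induction h with
  | refl _ h => exact h
  | step _ _ _ ih => exact ih

theorem mono (hST : S ⊆ T) (h : F.Joined S n u v) : F.Joined T n u v := by
  induction h with
  | refl n h => exact .refl n (hST h)
  | step hu h _ ih => exact .step (hST hu) h ih

theorem succ (h : F.Joined S n u v) : F.Joined S (n + 1) u v := by
  induction h with
  | refl n h => exact .refl _ h
  | step hu h _ ih => exact .step hu h ih

theorem snoc {w : V} (h : F.Joined S n u v) (hvw : F.Adj v w) (hw : w ∈ S) :
    F.Joined S (n + 1) u w := by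
  induction h with
  | refl n h => exact .step h hvw (.refl n hw)
  | step hu h _ ih => exact .step hu h (ih hvw)

theorem symm (h : F.Joined S n u v) : F.Joined S n v u := by
  induction h with
  | refl n h => exact .refl n h
  | step hu h _ ih => exact ih.snoc h.symm hu

/-- A property of the start that is preserved along the edges inside `S` holds at the end. -/
theorem invariant (h : F.Joined S n u v) {R : V → Prop}
    (hR : ∀ x ∈ S, ∀ y ∈ S, F.Adj x y → R x → R y) (hu : R u) : R v := by
  induction h with
  | refl n h => exact hu
  | step hu' h hw ih => exact ih (hR _ hu' _ hw.left_mem h hu)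

theorem inter_of_invariant (h : F.Joined S n u v) {R : V → Prop}
    (hR : ∀ x ∈ S, ∀ y ∈ S, F.Adj x y → R x → R y) (hu : R u) :
    F.Joined {x | x ∈ S ∧ R x} n u v := by
  induction h with
  | refl n h => exact .refl n ⟨h, hu⟩
  | step hu' h hw ih => exact .step ⟨hu', hu⟩ h (ih (hR _ hu' _ hw.left_mem h hu))

theorem key_eq (h : F.Joined S n u v) {β : Type*} {f : V → β}
    (hf : ∀ x ∈ S, ∀ y ∈ S, F.Adj x y → f x = f y) : f u = f v :=
  (h.invariant (R := fun x => f u = f x) (fun x hx y hy hxy hux => hux.trans (hf x hx y hy hxy))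
    rfl)

/-- A vertex whose neighbours in `S` are pairwise adjacent can be bypassed. -/
theorem bypass {m : V} (hm : ∀ x ∈ S, ∀ y ∈ S, F.Adj m x → F.Adj m y → x = y ∨ F.Adj x y)
    (hv : v ≠ m) (h : F.Joined S n u v) :
    (u ≠ m → F.Joined (S \ {m}) n u v) ∧
    (u = m → ∃ k x, n = k + 1 ∧ F.Adj m x ∧ x ≠ m ∧ F.Joined (S \ {m}) k x v) := by
  induction h with
  | refl n h => exact ⟨fun hu => .refl n ⟨h, hu⟩, fun hu => (hv hu).elim⟩
  | @step n u w v hu h hw ih =>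
    obtain ⟨ih1, ih2⟩ := ih hv
    refine ⟨fun hum => ?_, fun hum => ?_⟩
    · by_cases hwm : w = m
      · subst hwm
        obtain ⟨k, x, rfl, hx, hxm, hj⟩ := ih2 rfl
        rcases hm u hu x hj.left_mem.1 h.symm hx with rfl | hux
        · exact hj.succ.succ
        · exact (Joined.step (S := S \ {w}) ⟨hu, hum⟩ hux hj).succ
      · exact .step ⟨hu, hum⟩ h (ih1 hwm)
    · subst hum
      have hwm : w ≠ u := by
        rintro rfl
        rcases h with h | h <;> exact lt_irrefl _ (F.lt_of_E h)
      exact ⟨n, w, rfl, h, hwm, ih1 hwm⟩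

end Joined

/-- Walks between vertices of a set `U` that is closed under adjacent ancestors can avoid the
complement of `U`: the maximal vertices outside `U` have cliques as neighbourhoods and are bypassed
one by one. -/
theorem Joined.shortcut {S : Set V} (hS : S.Finite) {n : ℕ} {u v : V} {U : Set V}
    (hU : ∀ x ∈ S, ∀ y ∈ S, F.E x y → y ∈ U → x ∈ U) (h : F.Joined S n u v)
    (hu : u ∈ U) (hv : v ∈ U) : F.Joined (S ∩ U) n u v := by
  induction hk : (S \ U).ncard generalizing S with
  | zero =>
    have : S \ U = ∅ := (Set.ncard_eq_zero (hS.subset Set.sdiff_subset)).1 hk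
    exact h.mono fun x hx => ⟨hx, by
      by_contra hxU
      exact (this ▸ (⟨hx, hxU⟩ : x ∈ S \ U) : x ∈ (∅ : Set V))⟩
  | succ k ih =>
    have hfin : (S \ U).Finite := hS.subset Set.sdiff_subset
    have hne : (S \ U).Nonempty := by
      rw [← Set.ncard_pos hfin]; omega
    obtain ⟨m, hm⟩ := hfin.exists_maximal hne
    have hmS := hm.1
    have hnb : ∀ x ∈ S, F.Adj m x → F.E x m := by
      rintro x hx (h | h)
      · have hxU : x ∉ U := fun hxU => hmS.2 (hU m hmS.1 x hx h hxU)
        exact absurd (hm.2 ⟨hx, hxU⟩ (F.lt_of_E h).le) (F.lt_of_E h).not_ge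
      · exact h
    have hum : u ≠ m := fun e => hmS.2 (e ▸ hu)
    have hvm : v ≠ m := fun e => hmS.2 (e ▸ hv)
    have h1 := (h.bypass (m := m)
      (fun x hx y hy h1 h2 => E_clique (hnb x hx h1) (hnb y hy h2)) hvm).1 hum
    have h2 := ih (S := S \ {m}) (hS.subset Set.sdiff_subset)
      (fun x hx y hy => hU x hx.1 y hy.1) h1 (by
        have : (S \ {m}) \ U = (S \ U) \ {m} := by
          ext x; simp only [Set.mem_sdiff, Set.mem_singleton_iff]; tauto
        rw [this, Set.ncard_sdiff_singleton_of_mem hmS, hk]; rfl)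
    exact h2.mono fun x hx => ⟨hx.1.1, hx.2⟩

/-! ### Width, simplicity, antichains and breadth-first layers -/

open Classical in
/-- The ancestors of `v` in `A` that are adjacent to `v`. -/
noncomputable def back (F : ElimForest V) (A : Finset V) (v : V) : Finset V :=
  A.filter fun u => F.E u v

@[simp] theorem mem_back {A : Finset V} {u v : V} : u ∈ F.back A v ↔ u ∈ A ∧ F.E u v := by
  simp [back]

/-- Every vertex of `A` has at most `t` adjacent ancestors in `A`; this bounds the treewidth. -/
def WidthLE (F : ElimForest V) (A : Finset V) (t : ℕ) : Prop :=
  ∀ v ∈ A, (F.back A v).card ≤ t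

open Classical in
/-- The trace of `t`-simplicity: a set of `t` vertices lies in the closed ancestor neighbourhoods
of at most two vertices with `t` adjacent ancestors. -/
def IsSimple (F : ElimForest V) (A : Finset V) (t : ℕ) : Prop :=
  ∀ S ⊆ A, S.card = t →
    (A.filter fun v => (F.back A v).card = t ∧ S ⊆ insert v (F.back A v)).card ≤ 2

/-- The descendants in `A` of a vertex of `A` have no antichain with more than `k` elements: the
trees of the forest induced by `A` have at most `k` leaves. -/
def LeavesLE (A : Finset V) (k : ℕ) : Prop :=
  ∀ v ∈ A, ∀ W ⊆ A, (∀ w ∈ W, v ≤ w) → IsAntichain (· ≤ ·) (W : Set V) → W.card ≤ k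

theorem back_mono {A A' : Finset V} (h : A' ⊆ A) (v : V) : F.back A' v ⊆ F.back A v := by
  intro x; simp only [mem_back]; exact fun hx => ⟨h hx.1, hx.2⟩

theorem WidthLE.subset {A A' : Finset V} {t : ℕ} (hA : F.WidthLE A t) (h : A' ⊆ A) :
    F.WidthLE A' t :=
  fun v hv => (Finset.card_le_card (back_mono h v)).trans (hA v (h hv))

theorem LeavesLE.subset {A A' : Finset V} {k : ℕ} (hA : LeavesLE A k) (h : A' ⊆ A) :
    LeavesLE A' k :=
  fun v hv W hW => hA v (h hv) W (hW.trans h)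

theorem IsSimple.subset {A A' : Finset V} {t : ℕ} (hA : F.IsSimple A t) (hw : F.WidthLE A t)
    (h : A' ⊆ A) : F.IsSimple A' t := by
  classical
  intro S hS hc
  refine (Finset.card_le_card ?_).trans (hA S (hS.trans h) hc)
  intro v
  simp only [Finset.mem_filter]
  rintro ⟨hv, h1, h2⟩
  have : F.back A' v = F.back A v :=
    Finset.eq_of_subset_of_card_le (back_mono h v) (h1 ▸ hw v (h hv))
  exact ⟨h hv, this ▸ h1, this ▸ h2⟩

/-- `d` layers `A` in breadth-first fashion: it does not decrease from ancestors to descendants,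
grows by at most one along edges, and a vertex with an adjacent ancestor has one in the previous
layer. -/
structure IsLayering (F : ElimForest V) (A : Finset V) (d : V → ℕ) : Prop where
  mono : ∀ u ∈ A, ∀ v ∈ A, u ≤ v → d u ≤ d v
  le_succ : ∀ u ∈ A, ∀ v ∈ A, F.E u v → d v ≤ d u + 1
  exists_pred : ∀ v ∈ A, (F.back A v).Nonempty → ∃ u ∈ F.back A v, d v = d u + 1

theorem exists_layering (F : ElimForest V) (A : Finset V) : ∃ d, F.IsLayering A d := by
  classical
  induction hk : A.card generalizing A with
  | zero =>
    rw [Finset.card_eq_zero] at hk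
    subst hk
    exact ⟨fun _ => 0, by simp, by simp, by simp⟩
  | succ k ih =>
    obtain ⟨v, hv⟩ := A.exists_maximal (Finset.card_pos.1 (by omega))
    obtain ⟨d, hd⟩ := ih (A.erase v) (by rw [Finset.card_erase_of_mem hv.1, hk]; rfl)
    have hmax : ∀ x ∈ A, v ≤ x → x = v := fun x hx h => le_antisymm (hv.2 hx h) h
    have hvE : ∀ x ∈ A, ¬ F.E v x := fun x hx h =>
      (F.lt_of_E h).ne' (hmax x hx (F.lt_of_E h).le)
    have hback : ∀ x ∈ A, F.back A x = F.back (A.erase v) x := by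
      intro x hx
      ext y
      simp only [mem_back, Finset.mem_erase]
      refine ⟨fun h => ⟨⟨?_, h.1⟩, h.2⟩, fun h => ⟨h.1.2, h.2⟩⟩
      rintro rfl
      exact hvE x hx h.2
    have hbv : ∀ u ∈ F.back A v, u ∈ A.erase v := fun u hu => by
      rw [hback v hv.1] at hu; exact (mem_back.1 hu).1
    -- the layer of the new vertex
    obtain ⟨c, hc1, hc2, hc3⟩ : ∃ c : ℕ, (∀ u ∈ A.erase v, u ≤ v → d u ≤ c) ∧
        (∀ u ∈ F.back A v, c ≤ d u + 1) ∧
        ((F.back A v).Nonempty → ∃ u ∈ F.back A v, c = d u + 1) := by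
      by_cases hne : (F.back A v).Nonempty
      · obtain ⟨u₀, hu₀, hmin⟩ := Finset.exists_min_image _ d hne
        refine ⟨d u₀ + 1, ?_, fun u hu => by have := hmin u hu; omega, fun _ => ⟨u₀, hu₀, rfl⟩⟩
        intro w hw hwv
        have hu₀v := (mem_back.1 hu₀).2
        rcases F.comparable hwv (F.lt_of_E hu₀v).le with h | h
        · have := hd.mono w hw u₀ (hbv _ hu₀) h
          omega
        · rcases h.eq_or_lt with rfl | h
          · omega
          · exact hd.le_succ u₀ (hbv _ hu₀) w hw (F.E_of_E hu₀v h hwv)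
      · refine ⟨(A.erase v).sup d, fun u hu _ => Finset.le_sup (f := d) hu, ?_,
          fun h => (hne h).elim⟩
        intro u hu
        exact (hne ⟨u, hu⟩).elim
    have hne : ∀ x ∈ A, x ≠ v → Function.update d v c x = d x := fun x _ hx => by simp [hx]
    have hvv : Function.update d v c v = c := by simp
    refine ⟨Function.update d v c, ?_, ?_, ?_⟩
    · intro x hx y hy hxy
      by_cases hxv : x = v
      · subst hxv; rw [hmax y hy hxy]
      · rw [hne x hx hxv]
        by_cases hyv : y = v
        · subst hyv; rw [hvv]; exact hc1 x (by simp [hx, hxv]) hxy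
        · rw [hne y hy hyv]; exact hd.mono x (by simp [hx, hxv]) y (by simp [hy, hyv]) hxy
    · intro x hx y hy hxy
      have hxv : x ≠ v := by rintro rfl; exact hvE y hy hxy
      rw [hne x hx hxv]
      by_cases hyv : y = v
      · subst hyv; rw [hvv]; exact hc2 x (by simp [hx, hxy])
      · rw [hne y hy hyv]; exact hd.le_succ x (by simp [hx, hxv]) y (by simp [hy, hyv]) hxy
    · intro y hy hyn
      by_cases hyv : y = v
      · subst hyv
        obtain ⟨u, hu, h⟩ := hc3 hyn
        refine ⟨u, hu, ?_⟩
        rw [hvv, hne u (Finset.mem_of_mem_erase (hbv u hu)) (Finset.ne_of_mem_erase (hbv u hu)), h]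
      · rw [hback y hy] at hyn ⊢
        obtain ⟨u, hu, h⟩ := hd.exists_pred y (by simp [hy, hyv]) hyn
        refine ⟨u, hu, ?_⟩
        have hu' := (mem_back.1 hu).1
        rw [hne y hy hyv, hne u (Finset.mem_of_mem_erase hu') (Finset.ne_of_mem_erase hu'), h]

/-- A breadth-first layer has smaller width, because each vertex with an adjacent ancestor has one
in the previous layer. -/
theorem IsLayering.widthLE {A : Finset V} {d : V → ℕ} (hd : F.IsLayering A d) {t : ℕ}
    (hw : F.WidthLE A (t + 1)) (i : ℕ) : F.WidthLE (level A d i) t := by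
  intro v hv
  rw [mem_level] at hv
  by_cases hne : (F.back A v).Nonempty
  · obtain ⟨u, hu, hdu⟩ := hd.exists_pred v hv.1 hne
    have hss : F.back (level A d i) v ⊂ F.back A v := by
      refine Finset.ssubset_iff_subset_ne.2 ⟨back_mono (level_subset _ _ _) v, fun h => ?_⟩
      rw [← h, mem_back, mem_level] at hu
      omega
    have := Finset.card_lt_card hss
    have := hw v hv.1
    omega
  · have : F.back (level A d i) v = ∅ := by
      rw [← Finset.subset_empty, ← Finset.not_nonempty_iff_eq_empty.1 hne]
      exact back_mono (level_subset _ _ _) v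
    simp [this]

/-- A breadth-first layer of a simple structure of width `t + 1` is simple of width `t`. A vertex `v`
with `t` adjacent ancestors in its layer has exactly one adjacent ancestor `p` in the previous layer,
so `S ∪ {p}` witnesses simplicity of the whole structure; if two different `p` occur for the same
`S`, then the last vertex `s` of `S` uses up one of the two places for each of them. -/
theorem IsLayering.isSimple {A : Finset V} {d : V → ℕ} (hd : F.IsLayering A d) {t : ℕ} (ht : 1 ≤ t)
    (hw : F.WidthLE A (t + 1)) (hs : F.IsSimple A (t + 1)) (i : ℕ) :
    F.IsSimple (level A d i) t := by
  classical
  intro S hS hSc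
  set T := (level A d i).filter fun v => (F.back (level A d i) v).card = t ∧
    S ⊆ insert v (F.back (level A d i) v) with hT
  have hSA : ∀ x ∈ S, x ∈ A ∧ d x = i := fun x hx => mem_level.1 (hS hx)
  have hTA : ∀ v ∈ T, v ∈ A ∧ d v = i := fun v hv => mem_level.1 (Finset.mem_filter.1 hv).1
  have hex : ∀ v ∈ T, ∃ p, p ∈ A ∧ F.E p v ∧ d p + 1 = i ∧ (F.back A v).card = t + 1 ∧
      (∀ x ∈ S, x = v ∨ F.E x v) ∧ ∀ q ∈ A, F.E q v → d q + 1 = i → q = p := by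
    intro v hv
    obtain ⟨hvA, hdv⟩ := hTA v hv
    obtain ⟨-, hc, hSv⟩ := Finset.mem_filter.1 hv
    have hsub := back_mono (F := F) (level_subset A d i) v
    have hne : (F.back A v).Nonempty :=
      Finset.Nonempty.mono hsub (Finset.card_pos.1 (by omega))
    obtain ⟨p, hp, hdp⟩ := hd.exists_pred v hvA hne
    rw [mem_back] at hp
    have hpn : p ∉ F.back (level A d i) v := by
      rw [mem_back, mem_level]; omega
    have hins : insert p (F.back (level A d i) v) = F.back A v := by
      apply Finset.eq_of_subset_of_card_le
      · exact Finset.insert_subset (mem_back.2 hp) hsub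
      · rw [Finset.card_insert_of_notMem hpn, hc]; exact hw v hvA
    refine ⟨p, hp.1, hp.2, by omega, ?_, ?_, ?_⟩
    · rw [← hins, Finset.card_insert_of_notMem hpn, hc]
    · intro x hx
      rcases Finset.mem_insert.1 (hSv hx) with h | h
      · exact .inl h
      · exact .inr (mem_back.1 h).2
    · intro q hq hqv hdq
      have : q ∈ insert p (F.back (level A d i) v) := by rw [hins, mem_back]; exact ⟨hq, hqv⟩
      rcases Finset.mem_insert.1 this with h | h
      · exact h
      · have := (mem_level.1 (mem_back.1 h).1).2; omega
  choose! p hpA hpE hpd hpc hpS hpu using hex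
  have hpnS : ∀ q, d q + 1 = i → q ∉ S := fun q hq hqS => by have := (hSA q hqS).2; omega
  -- the sets `S ∪ {q}` that witness simplicity of `A`
  let C : V → Finset V := fun q => A.filter fun v => (F.back A v).card = t + 1 ∧
    insert q S ⊆ insert v (F.back A v)
  have hC : ∀ q ∈ A, d q + 1 = i → (C q).card ≤ 2 := by
    intro q hq hqi
    refine hs (insert q S) (Finset.insert_subset hq fun x hx => (hSA x hx).1) ?_
    rw [Finset.card_insert_of_notMem (hpnS q hqi), hSc]
  have hmemC : ∀ v ∈ T, v ∈ C (p v) := by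
    intro v hv
    refine Finset.mem_filter.2 ⟨(hTA v hv).1, hpc v hv, Finset.insert_subset ?_ ?_⟩
    · exact Finset.mem_insert_of_mem (mem_back.2 ⟨hpA v hv, hpE v hv⟩)
    · intro x hx
      rw [Finset.mem_insert, mem_back]
      exact (hpS v hv x hx).imp id fun h => ⟨(hSA x hx).1, h⟩
  by_cases hall : ∀ v₁ ∈ T, ∀ v₂ ∈ T, p v₁ = p v₂
  · rcases T.eq_empty_or_nonempty with h0 | ⟨v, hv⟩
    · rw [h0]; simp
    · exact (Finset.card_le_card fun w hw => hall v hv w hw ▸ hmemC w hw).trans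
        (hC _ (hpA v hv) (hpd v hv))
  push Not at hall
  obtain ⟨v₁, hv₁, v₂, hv₂, hne⟩ := hall
  obtain ⟨s, hsS⟩ := S.exists_maximal (Finset.card_pos.1 (by omega))
  have hsE : ∀ x ∈ S, x ≠ s → F.E x s := by
    intro x hx hxs
    have : F.Adj x s := by
      rcases hpS v₁ hv₁ x hx with h | h <;> rcases hpS v₁ hv₁ s hsS.1 with h' | h'
      · exact (hxs (h.trans h'.symm)).elim
      · exact .inr (h ▸ h')
      · exact .inl (h' ▸ h)
      · exact (E_clique h h').resolve_left hxs
    rcases this with h | h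
    · exact h
    · exact absurd (hsS.2 hx (F.lt_of_E h).le) (F.lt_of_E h).not_ge
  have hsA := hSA s hsS.1
  have hps : ∀ v ∈ T, F.E (p v) s := by
    intro v hv
    rcases hpS v hv s hsS.1 with h | h
    · rw [h]; exact hpE v hv
    · have hdp := hpd v hv
      rcases E_clique (hpE v hv) h with h | h | h
      · rw [← h] at hsA; omega
      · exact h
      · have := hd.mono s hsA.1 _ (hpA v hv) (F.lt_of_E h).le; omega
  have hsT : s ∉ T := fun h => hne <|
    (hpu s h _ (hpA _ hv₁) (hps _ hv₁) (hpd _ hv₁)).trans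
      (hpu s h _ (hpA _ hv₂) (hps _ hv₂) (hpd _ hv₂)).symm
  have hcard : (insert (p v₁) (insert (p v₂) (S.erase s))).card = t + 1 := by
    have h2 : p v₂ ∉ S.erase s := fun h => hpnS _ (hpd _ hv₂) (Finset.mem_of_mem_erase h)
    have h1 : p v₁ ∉ insert (p v₂) (S.erase s) := by
      rw [Finset.mem_insert]
      rintro (h | h)
      · exact hne h
      · exact hpnS _ (hpd _ hv₁) (Finset.mem_of_mem_erase h)
    rw [Finset.card_insert_of_notMem h1, Finset.card_insert_of_notMem h2,
      Finset.card_erase_of_mem hsS.1, hSc]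
    omega
  have hbs : insert (p v₁) (insert (p v₂) (S.erase s)) = F.back A s := by
    apply Finset.eq_of_subset_of_card_le
    · refine Finset.insert_subset (mem_back.2 ⟨hpA _ hv₁, hps _ hv₁⟩)
        (Finset.insert_subset (mem_back.2 ⟨hpA _ hv₂, hps _ hv₂⟩) fun x hx => ?_)
      rw [Finset.mem_erase] at hx
      exact mem_back.2 ⟨(hSA x hx.2).1, hsE x hx.2 hx.1⟩
    · rw [hcard]; exact hw s hsA.1
  have hsc : (F.back A s).card = t + 1 := hbs ▸ hcard
  have hsC : ∀ v ∈ T, s ∈ C (p v) := by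
    intro v hv
    refine Finset.mem_filter.2 ⟨hsA.1, hsc, Finset.insert_subset ?_ fun x hx => ?_⟩
    · exact Finset.mem_insert_of_mem (mem_back.2 ⟨hpA v hv, hps v hv⟩)
    · rw [Finset.mem_insert, mem_back]
      by_cases hxs : x = s
      · exact .inl hxs
      · exact .inr ⟨(hSA x hx).1, hsE x hx hxs⟩
  have hinj : Set.InjOn p (T : Set V) := by
    intro v hv v' hv' hvv
    by_contra hne'
    have hsub : ({s, v, v'} : Finset V) ⊆ C (p v) := by
      intro x hx
      simp only [Finset.mem_insert, Finset.mem_singleton] at hx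
      rcases hx with rfl | rfl | rfl
      · exact hsC v hv
      · exact hmemC x hv
      · exact hvv ▸ hmemC x hv'
    have h3 : ({s, v, v'} : Finset V).card = 3 :=
      Finset.card_eq_three.2 ⟨s, v, v', fun h => hsT (h ▸ hv), fun h => hsT (h ▸ hv'), hne', rfl⟩
    have := Finset.card_le_card hsub
    have := hC _ (hpA v hv) (hpd v hv)
    omega
  have himg : T.image p ⊆ {p v₁, p v₂} := by
    intro q hq
    obtain ⟨v, hv, rfl⟩ := Finset.mem_image.1 hq
    have : p v ∈ insert (p v₁) (insert (p v₂) (S.erase s)) := by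
      rw [hbs, mem_back]; exact ⟨hpA v hv, hps v hv⟩
    simp only [Finset.mem_insert] at this ⊢
    rcases this with h | h | h
    · exact .inl h
    · exact .inr (by simp [h])
    · exact (hpnS _ (hpd v hv) (Finset.mem_of_mem_erase h)).elim
  rw [← Finset.card_image_of_injOn hinj]
  exact (Finset.card_le_card himg).trans Finset.card_le_two

theorem IsLayering.le_add {A : Finset V} {d : V → ℕ} (hd : F.IsLayering A d) {S : Set V}
    (hS : ∀ x ∈ S, x ∈ A) {n : ℕ} {u v : V} (h : F.Joined S n u v) : d v ≤ d u + n := by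
  induction h with
  | refl n h => omega
  | @step n u w v hu h hw ih =>
    rcases h with h | h
    · have := hd.le_succ u (hS _ hu) w (hS _ hw.left_mem) h
      omega
    · have := hd.mono w (hS _ hw.left_mem) u (hS _ hu) (F.lt_of_E h).le
      omega

theorem eq_of_mod_eq {a b ℓ : ℕ} (h : a % (ℓ + 1) = b % (ℓ + 1)) (h1 : a ≤ b + ℓ)
    (h2 : b ≤ a + ℓ) : a = b := by
  rcases le_total a b with hab | hab
  · have := (Nat.modEq_iff_dvd' hab).1 h
    have := Nat.eq_zero_of_dvd_of_lt this (by omega)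
    omega
  · have := (Nat.modEq_iff_dvd' hab).1 h.symm
    have := Nat.eq_zero_of_dvd_of_lt this (by omega)
    omega

theorem mul_add_inj {a b m i j : ℕ} (h : a * m + i = b * m + j) (hi : i < m) (hj : j < m) :
    a = b ∧ i = j := by
  have h1 := congrArg (· / m) h
  have hm : 0 < m := by omega
  simp only [add_comm _ i, add_comm _ j] at h1
  rw [Nat.add_mul_div_right _ _ hm, Nat.add_mul_div_right _ _ hm, Nat.div_eq_of_lt hi,
    Nat.div_eq_of_lt hj] at h1
  have hab : a = b := by omega
  subst hab
  exact ⟨rfl, by omega⟩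

/-- Without edges every colouring is a ranking. -/
theorem isRank_of_widthLE_zero {A : Finset V} (hw : F.WidthLE A 0) (ℓ : ℕ) (φ : V → ℕ) :
    F.IsRank ℓ A φ := by
  intro u _ v _ _ h
  refine h.key_eq (f := id) fun x hx y hy hxy => ?_
  rcases hxy with h | h
  · have := Finset.card_eq_zero.1 (Nat.le_zero.1 (hw y hy.1))
    exact (Finset.notMem_empty x (this ▸ mem_back.2 ⟨hx.1, h⟩)).elim
  · have := Finset.card_eq_zero.1 (Nat.le_zero.1 (hw x hx.1))
    exact (Finset.notMem_empty y (this ▸ mem_back.2 ⟨hy.1, h⟩)).elim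

theorem LeavesLE.comparable {A : Finset V} (hA : LeavesLE A 1) {a b c : V} (ha : a ∈ A)
    (hb : b ∈ A) (hc : c ∈ A) (hab : a ≤ b) (hac : a ≤ c) : b ≤ c ∨ c ≤ b := by
  classical
  by_contra! h
  have h2 := hA a ha {b, c} (by simp [Finset.insert_subset_iff, hb, hc]) (by simp [hab, hac]) (by
    rw [Finset.coe_pair]
    exact Set.pairwise_pair.2 fun _ => ⟨h.1, h.2⟩)
  rw [Finset.card_pair (fun e => h.1 e.le)] at h2
  omega

/-- If descendants form chains, then comparability is preserved along walks. -/
theorem Joined.comparable_of_leavesLE_one {A : Finset V} (hA : LeavesLE A 1) {S : Set V}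
    (hS : ∀ x ∈ S, x ∈ A) {n : ℕ} {u v : V} (h : F.Joined S n u v) : u ≤ v ∨ v ≤ u := by
  classical
  refine h.invariant (R := fun x => u ≤ x ∨ x ≤ u) (fun x hx y hy hxy hux => ?_) (.inl le_rfl)
  have hu := h.left_mem
  rcases hux with h1 | h1 <;> rcases hxy.comparable with h2 | h2
  · exact .inl (h1.trans h2)
  · exact F.comparable h1 h2
  · exact hA.comparable (hS _ hx) (hS _ hu) (hS _ hy) h1 h2
  · exact .inr (h2.trans h1)

/-- If descendants form chains, boundedly many colours suffice. In each layer of a chain at most `t`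
vertices have neighbours in the next layer; these get colours of their own above all others, and what
is left decomposes into layers. -/
theorem exists_isRank_of_leavesLE_one (ℓ t : ℕ) {A : Finset V} (hw : F.WidthLE A t)
    (hA : LeavesLE A 1) :
    ∃ φ : V → ℕ, F.IsRank ℓ A φ ∧ ∀ v, φ v < t * t * (ℓ + 1) + 1 := by
  classical
  induction t generalizing A with
  | zero => exact ⟨fun _ => 0, isRank_of_widthLE_zero hw ℓ _, fun _ => by simp⟩
  | succ t ih =>
    obtain ⟨d, hd⟩ := F.exists_layering A
    choose ρ hρ hρc using fun i => ih (A := level A d i) (hd.widthLE hw i)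
      (hA.subset (level_subset _ _ _))
    let P : V → Prop := fun v => v ∈ A ∧ ∃ w ∈ A, F.E v w ∧ d w = d v + 1
    let idx : V → ℕ := fun v => (A.filter fun c => P c ∧ c < v ∧ d c = d v).card
    set c := t * t * (ℓ + 1) + 1 with hc
    have hidx : ∀ v, P v → idx v < t + 1 := by
      rintro v ⟨hv, w₀, hw₀, hvw₀, hdw₀⟩
      -- a vertex of the next layer adjacent to all special vertices up to `v` in the layer
      let X := A.filter fun w => v < w ∧ d w = d v + 1
      obtain ⟨w, hwX⟩ := X.exists_minimal
        ⟨w₀, Finset.mem_filter.2 ⟨hw₀, F.lt_of_E hvw₀, hdw₀⟩⟩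
      obtain ⟨hwA, hvw, hdw⟩ := Finset.mem_filter.1 hwX.1
      have hmem : ∀ x, P x → x ≤ v → d x = d v → x ∈ F.back A w := by
        rintro x ⟨hx, y, hy, hxy, hdy⟩ hxv hdx
        refine mem_back.2 ⟨hx, F.E_of_E hxy (hxv.trans_lt hvw) ?_⟩
        rcases hA.comparable hx hwA hy (hxv.trans hvw.le) (F.lt_of_E hxy).le with h | h
        · exact h
        · have hvy : v < y := by
            rcases hA.comparable hx hv hy hxv (F.lt_of_E hxy).le with h' | h'
            · refine h'.lt_of_ne ?_
              rintro rfl; omega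
            · have := hd.mono y hy v hv h'; omega
          exact hwX.2 (Finset.mem_filter.2 ⟨hy, hvy, by omega⟩) h
      have hss : (A.filter fun c => P c ∧ c < v ∧ d c = d v) ⊂ F.back A w := by
        refine Finset.ssubset_iff_subset_ne.2 ⟨fun x hx => ?_, fun h => ?_⟩
        · obtain ⟨-, h1, h2, h3⟩ := Finset.mem_filter.1 hx
          exact hmem x h1 h2.le h3
        · have := hmem v ⟨hv, w₀, hw₀, hvw₀, hdw₀⟩ le_rfl rfl
          rw [← h] at this
          exact lt_irrefl _ (Finset.mem_filter.1 this).2.2.1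
      exact (Finset.card_lt_card hss).trans_le (hw w hwA)
    have hidx_lt : ∀ x y, P x → P y → x < y → d x = d y → idx x < idx y := by
      intro x y hx _ hxy hdxy
      refine Finset.card_lt_card (Finset.ssubset_iff_subset_ne.2 ⟨fun z hz => ?_, fun h => ?_⟩)
      · obtain ⟨h0, h1, h2, h3⟩ := Finset.mem_filter.1 hz
        exact Finset.mem_filter.2 ⟨h0, h1, h2.trans hxy, by omega⟩
      · have : x ∈ A.filter fun c => P c ∧ c < y ∧ d c = d y :=
          Finset.mem_filter.2 ⟨hx.1, hx, hxy, hdxy⟩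
        rw [← h] at this
        exact lt_irrefl _ (Finset.mem_filter.1 this).2.2.1
    let φ : V → ℕ := fun v =>
      if P v then c + (d v % (ℓ + 1) * (t + 1) + idx v) else ρ (d v) v
    have hφP : ∀ v, P v → φ v = c + (d v % (ℓ + 1) * (t + 1) + idx v) := fun v hv => if_pos hv
    have hφn : ∀ v, ¬ P v → φ v = ρ (d v) v := fun v hv => if_neg hv
    refine ⟨φ, ?_, fun v => ?_⟩
    · intro u hu v hv huv hj
      by_cases hPu : P u
      · have hPv : P v := by
          by_contra hPv
          have := hρc (d v) v
          rw [hφP u hPu, hφn v hPv] at huv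
          omega
        rw [hφP u hPu, hφP v hPv] at huv
        obtain ⟨h1, h2⟩ := mul_add_inj (Nat.add_left_cancel huv) (hidx u hPu) (hidx v hPv)
        have hdd : d u = d v := eq_of_mod_eq h1 (hd.le_add (fun x hx => hx.1) hj.symm)
          (hd.le_add (fun x hx => hx.1) hj)
        rcases hj.comparable_of_leavesLE_one hA fun x hx => hx.1 with h | h
        · rcases h.eq_or_lt with h | h
          · exact h
          · have := hidx_lt u v hPu hPv h hdd; omega
        · rcases h.eq_or_lt with h | h
          · exact h.symm
          · have := hidx_lt v u hPv hPu h hdd.symm; omega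
      · have hlow : ∀ x, φ x ≤ φ u → ¬ P x := by
          intro x hx hPx
          have := hρc (d u) u
          rw [hφP x hPx, hφn u hPu] at hx
          omega
        have hdE : ∀ x ∈ A, ∀ y ∈ A, ¬ P x → F.E x y → d x = d y := by
          intro x hx y hy hPx hxy
          have h1 := hd.le_succ x hx y hy hxy
          have h2 := hd.mono x hx y hy (F.lt_of_E hxy).le
          by_contra hne
          exact hPx ⟨hx, y, hy, hxy, by omega⟩
        have hj' := hj.inter_of_invariant (R := fun x => d x = d u) (fun x hx y hy hxy hdx => by
          rcases hxy with h | h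
          · rw [← hdx]; exact (hdE x hx.1 y hy.1 (hlow x hx.2) h).symm
          · rw [← hdx]; exact hdE y hy.1 x hx.1 (hlow y hy.2) h) rfl
        have hdv : d v = d u := hj'.right_mem.2
        have hPv := hlow v huv.ge
        rw [hφn u hPu, hφn v hPv, hdv] at huv
        refine hρ (d u) u (by simp [hu]) v (by simp [hv, hdv]) huv (hj'.mono ?_)
        rintro x ⟨⟨hxA, hx⟩, hdx⟩
        refine ⟨mem_level.2 ⟨hxA, hdx⟩, ?_⟩
        have hPx := hlow x hx
        rwa [hφn u hPu, hφn x hPx, hdx] at hx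
    · by_cases hPv : P v
      · rw [hφP v hPv]
        have h1 := hidx v hPv
        have h2 : d v % (ℓ + 1) ≤ ℓ := Nat.lt_succ_iff.1 (Nat.mod_lt _ (by omega))
        have h3 := Nat.mul_le_mul_right (t + 1) h2
        nlinarith
      · rw [hφn v hPv]
        have := hρc (d v) v
        nlinarith

/-! ### Classes by number of leaves -/

open Classical in
/-- The number of maximal elements of `A` above `v`: the number of leaves of the forest induced by
`A` that descend from `v`. -/
noncomputable def leafCount (A : Finset V) (v : V) : ℕ :=
  (A.filter fun m => v ≤ m ∧ Maximal (· ∈ A) m).card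

theorem leafCount_anti (A : Finset V) {u v : V} (h : u ≤ v) : leafCount A v ≤ leafCount A u := by
  classical
  exact Finset.card_le_card fun m hm => by
    simp only [Finset.mem_filter] at hm ⊢
    exact ⟨hm.1, h.trans hm.2.1, hm.2.2⟩

theorem leafCount_pos {A : Finset V} {v : V} (hv : v ∈ A) : 0 < leafCount A v := by
  classical
  obtain ⟨m, hvm, hm⟩ := A.exists_le_maximal hv
  exact Finset.card_pos.2 ⟨m, Finset.mem_filter.2 ⟨hm.1, hvm, hm⟩⟩

theorem leafCount_le {A : Finset V} {k : ℕ} (hA : LeavesLE A k) {v : V} (hv : v ∈ A) :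
    leafCount A v ≤ k := by
  classical
  refine hA v hv _ (Finset.filter_subset _ _) (fun w hw => (Finset.mem_filter.1 hw).2.1) ?_
  intro x hx y hy hne hle
  simp only [Finset.coe_filter, Set.mem_ofPred_eq] at hx hy
  exact hne (le_antisymm hle (hx.2.2.2 hy.1 hle))

/-- Leaves below different members of an antichain are different, since the ancestors of a leaf form
a chain. -/
theorem sum_leafCount_le (F : ElimForest V) {A W : Finset V} {v : V} (hvW : ∀ w ∈ W, v ≤ w)
    (hW : IsAntichain (· ≤ ·) (W : Set V)) : ∑ w ∈ W, leafCount A w ≤ leafCount A v := by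
  classical
  unfold leafCount
  rw [← Finset.card_biUnion]
  · refine Finset.card_le_card fun m hm => ?_
    simp only [Finset.mem_biUnion, Finset.mem_filter] at hm ⊢
    obtain ⟨w, hw, h1, h2, h3⟩ := hm
    exact ⟨h1, (hvW w hw).trans h2, h3⟩
  · intro x hx y hy hne
    rw [Function.onFun, Finset.disjoint_left]
    intro m hmx hmy
    simp only [Finset.mem_filter] at hmx hmy
    rcases F.comparable hmx.2.1 hmy.2.1 with h | h
    · exact hW hx hy hne h
    · exact hW hy hx hne.symm h

/-- The vertices whose leaf number has a given order of magnitude to base `K` induce a forest whose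
trees have fewer than `K` leaves. -/
theorem leavesLE_level_log (F : ElimForest V) (A : Finset V) {K : ℕ} (hK : 2 ≤ K) (a : ℕ) :
    LeavesLE (level A (fun v => Nat.log K (leafCount A v)) a) (K - 1) := by
  intro v hv W hWA hvW hW
  rw [mem_level] at hv
  have h1 : ∑ w ∈ W, K ^ a ≤ ∑ w ∈ W, leafCount A w := by
    refine Finset.sum_le_sum fun w hw => ?_
    have hw' := mem_level.1 (hWA hw)
    rw [← hw'.2]
    exact Nat.pow_log_le_self K (leafCount_pos hw'.1).ne'
  have h2 : leafCount A v < K ^ (a + 1) := by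
    rw [← hv.2]; exact Nat.lt_pow_succ_log_self (by omega) _
  have h3 := h1.trans_lt ((sum_leafCount_le F hvW hW).trans_lt h2)
  rw [Finset.sum_const, smul_eq_mul, pow_succ, mul_comm] at h3
  have := Nat.lt_of_mul_lt_mul_left h3
  omega

theorem log_leafCount_anti (A : Finset V) (K : ℕ) {u v : V} (h : u ≤ v) :
    Nat.log K (leafCount A v) ≤ Nat.log K (leafCount A u) :=
  Nat.log_mono_right (leafCount_anti A h)

/-- If `a` does not increase from ancestors to descendants, then a walk below level `i` of `a` with
ends on level `i` can be shortened to a walk on level `i`. -/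
theorem Joined.shortcut_level {A : Finset V} {a : V → ℕ} (ha : ∀ u v, u ≤ v → a v ≤ a u)
    {S : Set V} (hS : ∀ x ∈ S, x ∈ A) {n i : ℕ} {u v : V} (h : F.Joined S n u v)
    (hle : ∀ x ∈ S, a x ≤ i) (hu : a u = i) (hv : a v = i) :
    F.Joined {x | x ∈ S ∧ a x = i} n u v := by
  refine (h.shortcut (A.finite_toSet.subset hS) (U := {x | i ≤ a x})
    (fun x _ y _ hxy hy => le_trans hy (ha x y (F.lt_of_E hxy).le)) hu.ge hv.ge).mono ?_
  exact fun x hx => ⟨hx.1, le_antisymm (hle x hx.1) hx.2⟩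

/-- With `k` leaves, `O(log k)` colours suffice: split the vertices into classes by the binary
logarithm of their leaf number, which induce forests of chains. -/
theorem exists_isRank_log (ℓ t k : ℕ) {A : Finset V} (hw : F.WidthLE A t) (hA : LeavesLE A k) :
    ∃ φ : V → ℕ, F.IsRank ℓ A φ ∧
      ∀ v ∈ A, φ v < (Nat.log 2 k + 1) * (t * t * (ℓ + 1) + 1) := by
  set a : V → ℕ := fun v => Nat.log 2 (leafCount A v) with ha
  set c := t * t * (ℓ + 1) + 1
  choose ρ hρ hρc using fun i => exists_isRank_of_leavesLE_one ℓ t (A := level A a i)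
    (hw.subset (level_subset _ _ _)) (leavesLE_level_log F A le_rfl i)
  refine ⟨fun v => a v * c + ρ (a v) v, ?_, fun v hv => ?_⟩
  · intro u hu v hv huv hj
    obtain ⟨h1, h2⟩ := mul_add_inj huv (hρc _ _) (hρc _ _)
    have hle : ∀ x, a x * c + ρ (a x) x ≤ a u * c + ρ (a u) u → a x ≤ a u := by
      intro x hx
      by_contra! hlt
      have := Nat.mul_le_mul_right c (Nat.succ_le_of_lt hlt)
      have := hρc (a u) u
      rw [Nat.succ_mul] at *
      omega
    have hj' := hj.shortcut_level (A := A) (a := a) (fun _ _ => log_leafCount_anti A 2)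
      (fun x hx => hx.1) (fun x hx => hle x hx.2) rfl h1.symm
    refine hρ (a u) u (by simp [hu]) v (by simp [hv, h1]) (by rw [h2, h1]) (hj'.mono ?_)
    rintro x ⟨⟨hxA, hx⟩, hax⟩
    refine ⟨mem_level.2 ⟨hxA, hax⟩, ?_⟩
    simp only [hax] at hx
    omega
  · have h1 : a v ≤ Nat.log 2 k := Nat.log_mono_right (leafCount_le hA hv)
    have h2 := hρc (a v) v
    have h3 := Nat.mul_le_mul_right c h1
    rw [Nat.succ_mul]
    show a v * c + ρ (a v) v < _
    omega

/-! ### The recursive step -/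

/-- A walk cannot leave the vertices of class at most `i` upwards if it starts too deep below the
vertices of higher class. -/
theorem Joined.class_le {A : Finset V} {d a : V → ℕ} (hd : F.IsLayering A d)
    (ha : ∀ u v, u ≤ v → a v ≤ a u) {S : Set V} (hS : ∀ x ∈ S, x ∈ A) {n i : ℕ} {u v : V}
    (h : F.Joined S n u v) (hu : a u ≤ i)
    (hdeep : ∀ w ∈ A, w ≤ u → i < a w → d w + n < d u) :
    F.Joined {x | x ∈ S ∧ a x ≤ i} n u v := by
  induction h with
  | refl n h => exact .refl n ⟨h, hu⟩
  | @step n u w v huS h hw ih =>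
    have hwS := hw.left_mem
    have hdw : d u ≤ d w + 1 := by
      rcases h with h | h
      · exact (hd.mono _ (hS _ huS) _ (hS _ hwS) (F.lt_of_E h).le).trans (Nat.le_succ _)
      · exact hd.le_succ _ (hS _ hwS) _ (hS _ huS) h
    have haw : a w ≤ i := by
      by_contra! hlt
      rcases h.comparable with h' | h'
      · exact (hlt.trans_le ((ha _ _ h').trans hu)).false
      · have := hdeep w (hS _ hwS) h' hlt; omega
    refine .step ⟨huS, hu⟩ h (ih haw fun x hx hxw hix => ?_)
    have hxu : x ≤ u := by
      rcases h.comparable with h' | h'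
      · rcases F.comparable hxw h' with h'' | h''
        · exact h''
        · exact (hix.trans_le ((ha _ _ h'').trans hu)).false.elim
      · exact hxw.trans h'
    have := hdeep x hx hxu hix
    omega

theorem exists_injOn_lt_card {α : Type*} (T : Finset α) :
    ∃ f : α → ℕ, Set.InjOn f T ∧ ∀ x ∈ T, f x < T.card := by
  classical
  refine ⟨fun x => if h : x ∈ T then T.equivFin ⟨x, h⟩ else 0, fun x hx y hy hxy => ?_,
    fun x hx => by simp [hx]⟩
  rw [Finset.mem_coe] at hx hy
  simp only [hx, hy, dif_pos, Fin.val_inj, EmbeddingLike.apply_eq_iff_eq, Subtype.mk.injEq] at hxy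
  exact hxy

/-- The recursive step. Split the vertices into classes by the logarithm to base `K` of their leaf
number. A vertex is deep if it lies more than `ℓ + 1` layers below every vertex of a higher class.
The shallow vertices of a class occupy `ℓ + 2` layers below the vertices of higher class; each class
has a palette for them, with a sub-palette for each of these layers, higher ones for higher layers.
The deep vertices of all classes share one large palette above these, because a short walk from a
deep vertex does not reach a higher class. The shallow vertices with deep neighbours in their class
are few in each component of the class and receive the highest colours, all distinct within such a
component; they separate deep vertices from the other shallow ones. -/
theorem exists_isRank_step (ℓ t k K f g : ℕ) {A : Finset V} {d : V → ℕ} (hd : F.IsLayering A d)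
    (hw : F.WidthLE A t) (hA : LeavesLE A k) (hK : 2 ≤ K)
    (hf : ∀ i, ∀ A' ⊆ level A d i, LeavesLE A' (K - 1) →
      ∃ φ : V → ℕ, F.IsRank ℓ A' φ ∧ ∀ v ∈ A', φ v < f)
    (hg : ∀ A' ⊆ A, LeavesLE A' (K - 1) → ∃ φ : V → ℕ, F.IsRank ℓ A' φ ∧ ∀ v ∈ A', φ v < g) :
    ∃ φ : V → ℕ, F.IsRank ℓ A φ ∧
      ∀ v ∈ A, φ v < (Nat.log K k + 1) * ((ℓ + 2) * f) + g + (K - 1) * t := by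
  classical
  set a : V → ℕ := fun v => Nat.log K (leafCount A v) with ha_def
  have ha : ∀ u v, u ≤ v → a v ≤ a u := fun _ _ => log_leafCount_anti A K
  have haK : ∀ v ∈ A, a v ≤ Nat.log K k := fun v hv => Nat.log_mono_right (leafCount_le hA hv)
  have hleaves : ∀ i, LeavesLE (level A a i) (K - 1) := leavesLE_level_log F A hK
  -- `ρ` colours the layers of the classes, `ρ'` colours the classes
  choose ρ hρ hρf using fun i j => hf j (level (level A a i) d j)
    (fun x hx => by simp only [mem_level] at hx ⊢; exact ⟨hx.1.1, hx.2⟩)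
    ((hleaves i).subset (level_subset _ _ _))
  choose ρ' hρ' hρg using fun i => hg (level A a i) (level_subset _ _ _) (hleaves i)
  -- adjacent vertices of equal class have the same ancestors of higher class
  have hup : ∀ x y, x ≤ y → a x = a y → ∀ w, w ≤ y → a y < a w → w ≤ x := by
    intro x y hxy haxy w hwy haw
    rcases F.comparable hwy hxy with h | h
    · exact h
    · have := ha x w h; omega
  let Deep : V → Prop := fun x => ∀ w ∈ A, w ≤ x → a x < a w → d w + (ℓ + 1) < d x
  have hdeep_down : ∀ x ∈ A, ∀ y ∈ A, x ≤ y → a x = a y → Deep x → Deep y := by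
    intro x hx y hy hxy haxy h w hw hwy haw
    have h1 := h w hw (hup x y hxy haxy w hwy haw) (haxy ▸ haw)
    have h2 := hd.mono x hx y hy hxy
    omega
  let Special : V → Prop := fun c => c ∈ A ∧ ¬ Deep c ∧ ∃ v ∈ A, Deep v ∧ a c = a v ∧ F.E c v
  have hspecial : ∀ c, Special c → ∀ w ∈ A, w ≤ c → a c < a w → d w + ℓ < d c := by
    rintro c ⟨hc, -, v, hv, hvD, hav, hcv⟩ w hw hwc haw
    have h1 := hvD w hw (hwc.trans (F.lt_of_E hcv).le) (hav ▸ haw)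
    have h2 := hd.le_succ c hc v hv hcv
    omega
  -- the top of the component of a vertex in its class
  have hz : ∀ x ∈ A, ∃ z ∈ A, z ≤ x ∧ a z = a x ∧ ∀ w ∈ A, w ≤ x → a w = a x → z ≤ w := by
    intro x hx
    obtain ⟨z, hz⟩ := (A.filter fun w => w ≤ x ∧ a w = a x).exists_minimal
      ⟨x, Finset.mem_filter.2 ⟨hx, le_rfl, rfl⟩⟩
    obtain ⟨hzA, hzx, haz⟩ := Finset.mem_filter.1 hz.1
    refine ⟨z, hzA, hzx, haz, fun w hw hwx haw => ?_⟩
    rcases F.comparable hzx hwx with h | h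
    · exact h
    · exact hz.2 (Finset.mem_filter.2 ⟨hw, hwx, haw⟩) h
  choose! z hzA hzle hza hzmin using hz
  have hz_eq : ∀ x ∈ A, ∀ y ∈ A, x ≤ y → a x = a y → z x = z y := by
    intro x hx y hy hxy haxy
    have h1 := hzmin y hy x hx hxy haxy
    exact le_antisymm (hzmin x hx _ (hzA y hy) h1 ((hza y hy).trans haxy.symm))
      (hzmin y hy _ (hzA x hx) ((hzle x hx).trans hxy) ((hza x hx).trans haxy))
  let Sp : V → Finset V := fun z₀ => A.filter fun c => Special c ∧ z c = z₀
  have hSp : ∀ z₀, (Sp z₀).card ≤ (K - 1) * t := by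
    intro z₀
    rcases (Sp z₀).eq_empty_or_nonempty with h0 | ⟨c₀, hc₀⟩
    · simp [h0]
    obtain ⟨hc₀A, -, hzc₀⟩ := Finset.mem_filter.1 hc₀
    -- every special vertex is adjacent to a topmost deep vertex of its component
    let D := A.filter fun r => Deep r ∧ z r = z₀
    let M := D.filter fun r => Minimal (· ∈ D) r
    have hD : ∀ r ∈ D, r ∈ A ∧ a r = a z₀ ∧ z₀ ≤ r := by
      intro r hr
      obtain ⟨h1, -, h2⟩ := Finset.mem_filter.1 hr
      exact ⟨h1, by rw [← h2, hza r h1], by rw [← h2]; exact hzle r h1⟩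
    have hMcard : M.card ≤ K - 1 := by
      refine hleaves (a z₀) z₀ (mem_level.2 ⟨hzc₀ ▸ hzA c₀ hc₀A, rfl⟩) M (fun r hr => ?_)
        (fun r hr => (hD r (Finset.mem_filter.1 hr).1).2.2) ?_
      · have := hD r (Finset.mem_filter.1 hr).1
        exact mem_level.2 ⟨this.1, this.2.1⟩
      · intro x hx y hy hne hle
        rw [Finset.mem_coe] at hx hy
        exact hne (le_antisymm hle
          ((Finset.mem_filter.1 hy).2.2 (Finset.mem_filter.1 hx).1 hle))
    have hsub : Sp z₀ ⊆ M.biUnion fun r => F.back A r := by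
      intro c hc
      obtain ⟨-, ⟨hcA, hcD, v, hv, hvD, hav, hcv⟩, hzc⟩ := Finset.mem_filter.1 hc
      have hvz : v ∈ D := Finset.mem_filter.2
        ⟨hv, hvD, by rw [← hzc]; exact (hz_eq c hcA v hv (F.lt_of_E hcv).le hav).symm⟩
      obtain ⟨r, hrv, hr⟩ := D.exists_le_minimal hvz
      obtain ⟨hrA, hrD, hrz⟩ := Finset.mem_filter.1 hr.1
      have har := (hD r hr.1).2.1
      have hac : a c = a z₀ := by rw [← hzc, hza c hcA]
      refine Finset.mem_biUnion.2 ⟨r, Finset.mem_filter.2 ⟨hr.1, hr⟩, mem_back.2 ⟨hcA, ?_⟩⟩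
      refine F.E_of_E hcv ?_ hrv
      rcases F.comparable hrv (F.lt_of_E hcv).le with h | h
      · exact (hcD (hdeep_down r hrA c hcA h (har.trans hac.symm) hrD)).elim
      · exact h.lt_of_ne fun e => hcD (e ▸ hrD)
    refine (Finset.card_le_card hsub).trans ((Finset.card_biUnion_le_card_mul _ _ t ?_).trans
      (Nat.mul_le_mul_right t hMcard))
    exact fun r hr => hw r (hD r (Finset.mem_filter.1 hr).1).1
  choose idx hidx hidxlt using fun z₀ => exists_injOn_lt_card (Sp z₀)
  have hmemSp : ∀ c, Special c → c ∈ Sp (z c) := fun c hc => Finset.mem_filter.2 ⟨hc.1, hc, rfl⟩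
  -- the last layer with an ancestor of higher class; it matters only at vertices that are not deep,
  -- which have such an ancestor
  let Q : V → ℕ := fun x => (A.filter fun w => w ≤ x ∧ a x < a w).sup d
  have hQ_eq : ∀ x y, x ≤ y → a x = a y → Q x = Q y := by
    intro x y hxy haxy
    have : (A.filter fun w => w ≤ x ∧ a x < a w) = A.filter fun w => w ≤ y ∧ a y < a w := by
      ext w
      simp only [Finset.mem_filter]
      exact ⟨fun h => ⟨h.1, h.2.1.trans hxy, haxy ▸ h.2.2⟩,
        fun h => ⟨h.1, hup x y hxy haxy w h.2.1 h.2.2, haxy ▸ h.2.2⟩⟩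
    simp only [Q, this]
  have hQ_le : ∀ x ∈ A, Q x ≤ d x := fun x hx => Finset.sup_le fun w hw => by
    simp only [Finset.mem_filter] at hw
    exact hd.mono w hw.1 x hx hw.2.1
  have hQ_ge : ∀ x, ¬ Deep x → d x ≤ Q x + (ℓ + 1) := by
    intro x hx
    simp only [Deep, not_forall, not_lt] at hx
    obtain ⟨w, hw, hwx, haw, h⟩ := hx
    have : d w ≤ Q x := Finset.le_sup (f := d) (Finset.mem_filter.2 ⟨hw, hwx, haw⟩)
    omega
  set m := (ℓ + 2) * f with hm
  set b₁ := (Nat.log K k + 1) * m with hb₁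
  let σ : V → ℕ := fun v => (ℓ + 1 - (d v - Q v)) * f + ρ (a v) (d v) v
  let φ : V → ℕ := fun v => if Special v then b₁ + g + idx (z v) v else
    if Deep v then b₁ + ρ' (a v) v else a v * m + σ v
  have hφS : ∀ v, Special v → φ v = b₁ + g + idx (z v) v := fun v h => if_pos h
  have hφD : ∀ v, ¬ Special v → Deep v → φ v = b₁ + ρ' (a v) v := fun v h h' => by
    simp only [φ, if_neg h, if_pos h']
  have hφL : ∀ v, ¬ Special v → ¬ Deep v → φ v = a v * m + σ v := fun v h h' => by
    simp only [φ, if_neg h, if_neg h']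
  have hρf' : ∀ v ∈ A, ρ (a v) (d v) v < f := fun v hv => hρf _ _ v (by simp [hv])
  have hρg' : ∀ v ∈ A, ρ' (a v) v < g := fun v hv => hρg _ v (by simp [hv])
  have hσ : ∀ v ∈ A, σ v < m := by
    intro v hv
    have h1 : (ℓ + 1 - (d v - Q v)) * f ≤ (ℓ + 1) * f := Nat.mul_le_mul_right f (Nat.sub_le _ _)
    have h2 := hρf' v hv
    have h3 : m = (ℓ + 1) * f + f := by rw [hm]; ring
    simp only [σ]
    omega
  have hL_lt : ∀ v ∈ A, ¬ Special v → ¬ Deep v → φ v < b₁ := by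
    intro v hv h h'
    rw [hφL v h h']
    have h1 := Nat.mul_le_mul_right m (haK v hv)
    have h2 := hσ v hv
    have h3 : b₁ = Nat.log K k * m + m := by rw [hb₁]; ring
    omega
  refine ⟨φ, ?_, fun v hv => ?_⟩
  swap
  · by_cases hS : Special v
    · rw [hφS v hS]
      have := (hidxlt (z v) v (hmemSp v hS)).trans_le (hSp (z v))
      omega
    by_cases hD : Deep v
    · rw [hφD v hS hD]
      have := hρg' v hv
      omega
    · have := hL_lt v hv hS hD
      omega
  intro u hu v hv huv hj
  set S : Set V := {x | x ∈ A ∧ φ x ≤ φ u} with hSdef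
  have hSA : ∀ x ∈ S, x ∈ A := fun x hx => hx.1
  -- two vertices that are deep below the higher classes lie in the same class
  have hsame : (∀ w ∈ A, w ≤ u → a u < a w → d w + ℓ < d u) →
      (∀ w ∈ A, w ≤ v → a v < a w → d w + ℓ < d v) →
      a v = a u ∧ F.Joined {x | x ∈ S ∧ a x = a u} ℓ u v := by
    intro h1 h2
    have h3 := hj.class_le hd ha hSA le_rfl h1
    have h4 := hj.symm.class_le hd ha hSA le_rfl h2
    have h5 : a v = a u := le_antisymm h3.right_mem.2 h4.right_mem.2
    refine ⟨h5, (h3.shortcut_level (A := A) ha (fun x hx => hSA x hx.1) (fun x hx => hx.2) rfl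
      h5).mono fun x hx => ⟨hx.1.1, hx.2⟩⟩
  by_cases hSu : Special u
  · have hSv : Special v := by
      by_contra hSv
      rw [hφS u hSu] at huv
      by_cases hDv : Deep v
      · have := hρg' v hv
        rw [hφD v hSv hDv] at huv; omega
      · have := hL_lt v hv hSv hDv; omega
    obtain ⟨-, hj'⟩ := hsame (hspecial u hSu) (hspecial v hSv)
    have hzz : z u = z v := hj'.key_eq fun x hx y hy hxy => by
      rcases hxy.comparable with h | h
      · exact hz_eq x (hSA x hx.1) y (hSA y hy.1) h (hx.2.trans hy.2.symm)
      · exact (hz_eq y (hSA y hy.1) x (hSA x hx.1) h (hy.2.trans hx.2.symm)).symm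
    rw [hφS u hSu, hφS v hSv, hzz] at huv
    exact hidx (z v) (hzz ▸ hmemSp u hSu) (hmemSp v hSv) (by omega)
  by_cases hDu : Deep u
  · have hφu := hφD u hSu hDu
    have hgu := hρg' u hu
    have hSn : ∀ x, φ x ≤ φ u → ¬ Special x := by
      intro x hx hSx
      rw [hφS x hSx] at hx
      omega
    have hDv : Deep v := by
      by_contra hDv
      have := hL_lt v hv (hSn v huv.ge) hDv
      omega
    obtain ⟨hav, hj'⟩ := hsame (fun w h1 h2 h3 => by have := hDu w h1 h2 h3; omega)
      (fun w h1 h2 h3 => by have := hDv w h1 h2 h3; omega)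
    have hj'' := hj'.inter_of_invariant (R := Deep) (fun x hx y hy hxy hDx => by
      have haxy : a x = a y := hx.2.trans hy.2.symm
      rcases hxy with h | h
      · exact hdeep_down x hx.1.1 y hy.1.1 (F.lt_of_E h).le haxy hDx
      · by_contra hDy
        exact hSn y hy.1.2 ⟨hy.1.1, hDy, x, hx.1.1, hDx, haxy.symm, h⟩) hDu
    have hφx : ∀ x ∈ S, Deep x → φ x = b₁ + ρ' (a x) x := fun x hx h => hφD x (hSn x hx.2) h
    have hvS : v ∈ S := ⟨hv, huv.ge⟩
    refine hρ' (a u) u (by simp [hu]) v (by simp [hv, hav]) ?_ (hj''.mono ?_)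
    · rw [hφu, hφx v hvS hDv, hav] at huv
      omega
    · rintro x ⟨⟨hxS, hax⟩, hxD⟩
      refine ⟨mem_level.2 ⟨hxS.1, hax⟩, ?_⟩
      have := hxS.2
      rw [hφx x hxS hxD, hφu, hax] at this
      omega
  -- both ends are shallow, hence so is the whole walk
  have hLu := hL_lt u hu hSu hDu
  have hSn : ∀ x, φ x ≤ φ u → ¬ Special x := by
    intro x hx hSx
    rw [hφS x hSx] at hx
    omega
  have hDn : ∀ x, φ x ≤ φ u → ¬ Deep x := by
    intro x hx hDx
    rw [hφD x (hSn x hx) hDx] at hx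
    omega
  have hφx : ∀ x, φ x ≤ φ u → φ x = a x * m + σ x := fun x hx => hφL x (hSn x hx) (hDn x hx)
  have hφu := hφx u le_rfl
  obtain ⟨hav, hσv⟩ := mul_add_inj (by rw [← hφu, ← hφx v huv.ge, huv]) (hσ u hu) (hσ v hv)
  have hle : ∀ x ∈ S, a x ≤ a u := by
    intro x hx
    have h1 := hx.2
    rw [hφx x hx.2, hφu] at h1
    by_contra! hlt
    have h2 := Nat.mul_le_mul_right m (Nat.succ_le_of_lt hlt)
    have h3 := hσ u hu
    rw [Nat.succ_mul] at h2
    omega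
  have hj₁ := hj.shortcut_level (A := A) ha hSA hle rfl hav.symm
  have hj₂ := hj₁.inter_of_invariant (R := fun x => Q x = Q u) (fun x hx y hy hxy hQx => by
    rw [← hQx]
    rcases hxy.comparable with h | h
    · exact (hQ_eq x y h (hx.2.trans hy.2.symm)).symm
    · exact hQ_eq y x h (hy.2.trans hx.2.symm)) rfl
  have hσle : ∀ x ∈ S, a x = a u → σ x ≤ σ u := by
    intro x hx hax
    have h1 := hx.2
    rw [hφx x hx.2, hφu, hax] at h1
    omega
  have hdge : ∀ x ∈ S, a x = a u → Q x = Q u → d u ≤ d x := by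
    intro x hx hax hQx
    have h1 := hσle x hx hax
    simp only [σ] at h1
    have h2 := hρf' u hu
    have h3 := hQ_le x hx.1
    have h4 := hQ_le u hu
    have h5 := hQ_ge u hDu
    by_contra! hlt
    have h6 := Nat.mul_le_mul_right f
      (show ℓ + 1 - (d u - Q u) + 1 ≤ ℓ + 1 - (d x - Q x) by omega)
    rw [Nat.succ_mul] at h6
    omega
  have hQv : Q v = Q u := hj₂.right_mem.2
  obtain ⟨hdv', hρv⟩ := mul_add_inj hσv (hρf' u hu) (hρf' v hv)
  have hdv : d v = d u := by
    have h3 := hQ_le v hv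
    have h4 := hQ_le u hu
    have h5 := hQ_ge u hDu
    have h6 := hQ_ge v (hDn v huv.ge)
    omega
  have hj₃ := hj₂.shortcut (A.finite_toSet.subset fun x hx => hx.1.1.1) (U := {x | d x ≤ d u})
    (fun x hx y hy hxy hdy => (hd.mono x hx.1.1.1 y hy.1.1.1 (F.lt_of_E hxy).le).trans hdy)
    (show d u ≤ d u from le_rfl) (show d v ≤ d u from hdv.le)
  refine hρ (a u) (d u) u (by simp [hu]) v (by simp [hv, hav, hdv]) ?_ (hj₃.mono ?_)
  · rw [hρv, hav, hdv]
  · rintro x ⟨⟨⟨hxS, hax⟩, hQx⟩, hdx⟩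
    have hdx' : d x = d u := le_antisymm hdx (hdge x hxS hax hQx)
    refine ⟨by simp [hxS.1, hax, hdx'], ?_⟩
    have h1 := hσle x hxS hax
    simp only [σ, hax, hdx', hQx] at h1
    omega

/-! ### Simple structures of width one -/

/-- In a simple structure of width one the vertices with a parent form paths, along which colours can
be repeated periodically; the roots get an additional colour. -/
theorem exists_isRank_of_isSimple_one (ℓ : ℕ) {A : Finset V} (hw : F.WidthLE A 1)
    (hs : F.IsSimple A 1) : ∃ φ : V → ℕ, F.IsRank ℓ A φ ∧ ∀ v, φ v < ℓ + 2 := by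
  classical
  obtain ⟨d, hd⟩ := F.exists_layering A
  let N : V → Prop := fun v => (F.back A v).Nonempty
  let φ : V → ℕ := fun v => if N v then d v % (ℓ + 1) else ℓ + 1
  have hφN : ∀ v, N v → φ v = d v % (ℓ + 1) := fun v h => if_pos h
  have hφR : ∀ v, ¬ N v → φ v = ℓ + 1 := fun v h => if_neg h
  have hmod : ∀ v, d v % (ℓ + 1) < ℓ + 1 := fun v => Nat.mod_lt _ (by omega)
  have hNiff : ∀ v, N v ↔ φ v < ℓ + 1 := by
    intro v
    by_cases h : N v
    · simp [h, hφN v h, hmod v]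
    · simp [h, hφR v h]
  have hparent : ∀ v ∈ A, ∀ x ∈ A, ∀ y ∈ A, F.E x v → F.E y v → x = y := fun v hv x hx y hy h1 h2 =>
    Finset.card_le_one.1 (hw v hv) x (mem_back.2 ⟨hx, h1⟩) y (mem_back.2 ⟨hy, h2⟩)
  have hcard : ∀ v ∈ A, N v → (F.back A v).card = 1 := fun v hv h =>
    le_antisymm (hw v hv) (Finset.card_pos.2 h)
  have hchild : ∀ v ∈ A, N v → ∀ x ∈ A, ∀ y ∈ A, F.E v x → F.E v y → x = y := by
    intro v hv hN x hx y hy h1 h2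
    by_contra hne
    have hsub : ({v, x, y} : Finset V) ⊆
        A.filter fun w => (F.back A w).card = 1 ∧ {v} ⊆ insert w (F.back A w) := by
      intro w hw'
      simp only [Finset.mem_insert, Finset.mem_singleton] at hw'
      simp only [Finset.mem_filter, Finset.singleton_subset_iff, Finset.mem_insert, mem_back]
      rcases hw' with rfl | rfl | rfl
      · exact ⟨hv, hcard w hv hN, .inl rfl⟩
      · exact ⟨hx, hcard w hx ⟨v, mem_back.2 ⟨hv, h1⟩⟩, .inr ⟨hv, h1⟩⟩
      · exact ⟨hy, hcard w hy ⟨v, mem_back.2 ⟨hv, h2⟩⟩, .inr ⟨hv, h2⟩⟩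
    have h3 : ({v, x, y} : Finset V).card = 3 :=
      Finset.card_eq_three.2 ⟨v, x, y, (F.lt_of_E h1).ne, (F.lt_of_E h2).ne, hne, rfl⟩
    have := Finset.card_le_card hsub
    have := hs {v} (by simpa using hv) (by simp)
    omega
  refine ⟨φ, ?_, fun v => ?_⟩
  swap
  · by_cases h : N v
    · rw [hφN v h]; have := hmod v; omega
    · rw [hφR v h]; omega
  intro u hu v hv huv hj
  by_cases hNu : N u
  · have hNx : ∀ x, φ x ≤ φ u → N x := fun x hx => (hNiff x).2 (hx.trans_lt ((hNiff u).1 hNu))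
    have hNv := hNx v huv.ge
    let r : V → V → Prop := fun x y => x ∈ A ∧ y ∈ A ∧ N x ∧ F.E x y
    have hrd : ∀ x y, Relation.ReflTransGen r x y → x = y ∨ d x < d y := by
      intro x y h
      induction h with
      | refl => exact .inl rfl
      | @tail b c _ h ih =>
        obtain ⟨hb, hc, -, hbc⟩ := h
        obtain ⟨p, hp, hdp⟩ := hd.exists_pred c hc ⟨b, mem_back.2 ⟨hb, hbc⟩⟩
        rw [mem_back] at hp
        rw [hparent c hc p hp.1 b hb hp.2 hbc] at hdp
        rcases ih with rfl | h
        · right; omega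
        · right; omega
    have hrel : Relation.ReflTransGen r u v ∨ Relation.ReflTransGen r v u := by
      refine hj.invariant (R := fun x => Relation.ReflTransGen r u x ∨ Relation.ReflTransGen r x u)
        (fun x hx y hy hxy hux => ?_) (.inl .refl)
      rcases hxy with h | h <;> rcases hux with hux | hux
      · exact .inl (hux.tail ⟨hx.1, hy.1, hNx x hx.2, h⟩)
      · rcases hux.cases_head with rfl | ⟨c, ⟨h1, h2, h3, h4⟩, hcu⟩
        · exact .inl (.single ⟨hx.1, hy.1, hNx x hx.2, h⟩)
        · rw [hchild x hx.1 h3 c h2 y hy.1 h4 h] at hcu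
          exact .inr hcu
      · rcases hux.cases_tail with rfl | ⟨c, hcu, ⟨h1, h2, h3, h4⟩⟩
        · exact .inr (.single ⟨hy.1, hx.1, hNx y hy.2, h⟩)
        · rw [hparent x hx.1 c h1 y hy.1 h4 h] at hcu
          exact .inl hcu
      · exact .inr (hux.head ⟨hy.1, hx.1, hNx y hy.2, h⟩)
    rw [hφN u hNu, hφN v hNv] at huv
    have hdd : d u = d v := eq_of_mod_eq huv (hd.le_add (fun x hx => hx.1) hj.symm)
      (hd.le_add (fun x hx => hx.1) hj)
    rcases hrel with h | h
    · rcases hrd _ _ h with h | h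
      · exact h
      · omega
    · rcases hrd _ _ h with h | h
      · exact h.symm
      · omega
  · have hNv : ¬ N v := by rw [hNiff] at hNu ⊢; omega
    have hj' := hj.shortcut (A.finite_toSet.subset fun x hx => hx.1) (U := {x | ¬ N x})
      (fun x hx y _ hxy hy => (hy ⟨x, mem_back.2 ⟨hx.1, hxy⟩⟩).elim) hNu hNv
    refine hj'.key_eq (f := id) fun x hx y hy hxy => ?_
    rcases hxy with h | h
    · exact (hy.2 ⟨x, mem_back.2 ⟨hx.1.1, h⟩⟩).elim
    · exact (hx.2 ⟨y, mem_back.2 ⟨hy.1.1, h⟩⟩).elim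

end ElimForest

/-! ### Iterated logarithms -/

theorem tendsto_iteratedLog (i : ℕ) : Tendsto (iteratedLog i) atTop atTop := by
  induction i with
  | zero => exact tendsto_id
  | succ i ih => exact Real.tendsto_log_atTop.comp ih

theorem iteratedLog_log (i : ℕ) (x : ℝ) : iteratedLog i (Real.log x) = iteratedLog (i + 1) x := by
  induction i with
  | zero => rfl
  | succ i ih => rw [iteratedLog, ih]; rfl

/-- If the logarithms of two functions are comparable, then so are their iterated logarithms. -/
theorem exists_mul_iteratedLog_le {α : Type*} {l : Filter α} {x y : α → ℝ}
    (hx : Tendsto x l atTop) {c : ℝ} (hc : 0 < c)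
    (h : ∀ᶠ n in l, c * Real.log (x n) ≤ Real.log (y n)) (i : ℕ) :
    ∃ c' : ℝ, 0 < c' ∧ ∀ᶠ n in l, c' * iteratedLog (i + 1) (x n) ≤ iteratedLog (i + 1) (y n) := by
  induction i with
  | zero => exact ⟨c, hc, h⟩
  | succ i ih =>
    obtain ⟨c', hc', h'⟩ := ih
    refine ⟨1 / 2, by norm_num, ?_⟩
    have h1 := (tendsto_iteratedLog (i + 1)).comp hx
    have h2 := (tendsto_iteratedLog (i + 2)).comp hx
    filter_upwards [h', h1.eventually_gt_atTop 0, h2.eventually_ge_atTop (-2 * Real.log c')]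
      with n hn h1n h2n
    simp only [Function.comp_apply] at h1n h2n
    have h3 := Real.log_le_log (mul_pos hc' h1n) hn
    rw [Real.log_mul hc'.ne' h1n.ne'] at h3
    change -2 * Real.log c' ≤ Real.log (iteratedLog (i + 1) (x n)) at h2n
    show 1 / 2 * Real.log (iteratedLog (i + 1) (x n)) ≤ Real.log (iteratedLog (i + 1) (y n))
    linarith

theorem eventually_iteratedLog_le (i : ℕ) :
    ∀ᶠ x : ℝ in atTop, iteratedLog (i + 2) x ≤ 2 * √(Real.log x) := by
  induction i with
  | zero =>
    filter_upwards [Real.tendsto_log_atTop.eventually_gt_atTop 0] with x hx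
    have h1 : Real.log (Real.log x) = 2 * Real.log √(Real.log x) := by
      rw [Real.log_sqrt hx.le]; ring
    show Real.log (Real.log x) ≤ _
    rw [h1]
    exact mul_le_mul_of_nonneg_left (Real.log_le_self (Real.sqrt_nonneg _)) (by norm_num)
  | succ i ih =>
    filter_upwards [ih, (tendsto_iteratedLog (i + 2)).eventually_ge_atTop 0] with x hx h0
    exact (Real.log_le_self h0).trans hx

/-- The count of colours in the recursive step. With `f` colours for `k' ≈ √(log k)` leaves, one
width lower, and classes with respect to base `k' + 1`, the total for `k` leaves has the claimed
order. -/
theorem exists_step_bound (ℓ t T : ℕ) (C : ℝ) (hC : 0 ≤ C) :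
    ∃ C' : ℝ, ∀ᶠ k : ℕ in atTop, ∀ k' f : ℕ, k' = ⌈√(Real.log k)⌉₊ + 1 →
      f = ⌊C * (Real.log k' / iteratedLog (t + 1) k')⌋₊ →
      (((Nat.log (k' + 1) k + 1) * ((ℓ + 2) * f) + (Nat.log 2 k' + 1) * T + k' * T : ℕ) : ℝ) ≤
        C' * (Real.log k / iteratedLog (t + 2) k) := by
  have hcast : Tendsto (fun k : ℕ => (k : ℝ)) atTop atTop := tendsto_natCast_atTop_atTop
  have hlog : Tendsto (fun k : ℕ => Real.log k) atTop atTop := Real.tendsto_log_atTop.comp hcast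
  have hsqrt : Tendsto (fun k : ℕ => √(Real.log k)) atTop atTop :=
    Real.tendsto_sqrt_atTop.comp hlog
  let y : ℕ → ℝ := fun k => ((⌈√(Real.log k)⌉₊ + 1 : ℕ) : ℝ)
  have hy : ∀ k : ℕ, √(Real.log k) + 1 ≤ y k := fun k => by
    simp only [y]; push_cast
    have := Nat.le_ceil √(Real.log k)
    linarith
  have hy2 : ∀ k : ℕ, y k ≤ √(Real.log k) + 2 := fun k => by
    simp only [y]; push_cast
    have := Nat.ceil_lt_add_one (Real.sqrt_nonneg (Real.log k))
    linarith
  obtain ⟨c, hc, hcy⟩ := exists_mul_iteratedLog_le (l := atTop) (x := fun k : ℕ => Real.log k)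
    (y := y) hlog (c := 1 / 2) (by norm_num) (by
      filter_upwards [hlog.eventually_gt_atTop 0] with k hk
      have h1 : Real.log √(Real.log k) ≤ Real.log (y k) :=
        Real.log_le_log (Real.sqrt_pos.2 hk) (by have := hy k; linarith)
      rw [Real.log_sqrt hk.le] at h1
      linarith) t
  refine ⟨2 * (ℓ + 2) * C / c + 12 * T, ?_⟩
  have hit := ((tendsto_iteratedLog (t + 2)).comp hcast).eventually_gt_atTop 0
  filter_upwards [hcy, hit, hcast.eventually (eventually_iteratedLog_le t),
    hsqrt.eventually_ge_atTop 2, eventually_ge_atTop 2] with k h1 h2 h3 h4 hk2 k' f hk' hf₀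
  simp only [Function.comp_apply] at h2
  rw [iteratedLog_log] at h1
  have hyk : y k = (k' : ℝ) := by rw [hk']
  have hk'1 : √(Real.log k) + 1 ≤ k' := hyk ▸ hy k
  have hk'2 : (k' : ℝ) ≤ √(Real.log k) + 2 := hyk ▸ hy2 k
  rw [hyk] at h1
  set s := √(Real.log k) with hs
  set I := iteratedLog (t + 2) (k : ℝ) with hI
  set J := iteratedLog (t + 1) (k' : ℝ) with hJ
  have hs2 : s * s = Real.log k := Real.mul_self_sqrt (by
    apply Real.log_nonneg; exact_mod_cast (by omega : 1 ≤ k))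
  have hJpos : 0 < J := (mul_pos hc h2).trans_le h1
  have hk'log : 0 < Real.log k' := Real.log_pos (by linarith)
  have hf : (f : ℝ) ≤ C * (Real.log k' / J) := by
    rw [hf₀]; exact Nat.floor_le (by positivity)
  have hlk : Real.log k' ≤ Real.log k := by
    have := Real.log_le_self (x := (k' : ℝ)) (by positivity)
    nlinarith
  have hcl : (Nat.log (k' + 1) k : ℝ) ≤ Real.log k / Real.log k' := by
    have h5 : (Nat.log (k' + 1) k : ℝ) * Real.log (k' + 1 : ℕ) ≤ Real.log k := by
      rw [← Real.log_pow]
      apply Real.log_le_log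
      · positivity
      · exact_mod_cast Nat.pow_log_le_self (k' + 1) (by omega)
    have h6 : Real.log k' ≤ Real.log (k' + 1 : ℕ) :=
      Real.log_le_log (by linarith) (by push_cast; linarith)
    rw [le_div_iff₀ hk'log]
    exact (mul_le_mul_of_nonneg_left h6 (by positivity)).trans h5
  have hcl2 : (Nat.log (k' + 1) k : ℝ) + 1 ≤ 2 * (Real.log k / Real.log k') := by
    have : 1 ≤ Real.log k / Real.log k' := (one_le_div hk'log).2 hlk
    linarith
  have hlogk : 0 ≤ Real.log k := hk'log.le.trans hlk
  have hA : ((Nat.log (k' + 1) k : ℝ) + 1) * f ≤ 2 * C / c * (Real.log k / I) := by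
    calc ((Nat.log (k' + 1) k : ℝ) + 1) * f
        ≤ (2 * (Real.log k / Real.log k')) * (C * (Real.log k' / J)) :=
          mul_le_mul hcl2 hf (by positivity) (by positivity)
      _ = 2 * C * Real.log k * J⁻¹ := by field_simp
      _ ≤ 2 * C * Real.log k * (c * I)⁻¹ := by
          apply mul_le_mul_of_nonneg_left (inv_anti₀ (mul_pos hc h2) h1) (by positivity)
      _ = 2 * C / c * (Real.log k / I) := by field_simp
  have hB : s ≤ 2 * (Real.log k / I) := by
    rw [← mul_div_assoc, le_div_iff₀ h2, ← hs2]
    nlinarith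
  have hl2 : ((Nat.log 2 k' : ℕ) : ℝ) ≤ k' := by exact_mod_cast Nat.log_le_self 2 k'
  have hD : ((Nat.log 2 k' : ℝ) + 1) + k' ≤ 6 * s := by linarith
  push_cast
  have hE : (((Nat.log 2 k' : ℝ) + 1) + k') * T ≤ 6 * (2 * (Real.log k / I)) * T :=
    mul_le_mul_of_nonneg_right (hD.trans (by linarith)) (by positivity)
  have hF := mul_le_mul_of_nonneg_left hA (show (0 : ℝ) ≤ ℓ + 2 by positivity)
  calc _ = (ℓ + 2) * (((Nat.log (k' + 1) k : ℝ) + 1) * f)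
        + (((Nat.log 2 k' : ℝ) + 1) + k') * T := by ring
    _ ≤ _ := add_le_add hF hE
    _ = _ := by ring

namespace ElimForest

/-- The upper bound for forest-ordered chordal graphs, in terms of the number of leaves. -/
theorem exists_isRank_iteratedLog (ℓ t : ℕ) : ∃ C : ℝ, 0 ≤ C ∧ ∃ N : ℕ, ∀ k, N ≤ k →
    ∀ {V : Type*} [PartialOrder V] (F : ElimForest V) (A : Finset V), F.WidthLE A (t + 1) →
      F.IsSimple A (t + 1) → LeavesLE A k → ∃ (φ : V → ℕ) (m : ℕ), F.IsRank ℓ A φ ∧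
        (∀ v ∈ A, φ v < m) ∧ (m : ℝ) ≤ C * (Real.log k / iteratedLog (t + 1) k) := by
  induction t with
  | zero =>
    refine ⟨ℓ + 2, by positivity, 2, fun k hk V _ F A hw hs _ => ?_⟩
    obtain ⟨φ, hφ, hlt⟩ := exists_isRank_of_isSimple_one ℓ hw hs
    refine ⟨φ, ℓ + 2, hφ, fun v _ => hlt v, ?_⟩
    have : 0 < Real.log k := Real.log_pos (by exact_mod_cast hk)
    change _ ≤ _ * (Real.log k / Real.log k)
    rw [div_self this.ne']
    push_cast; linarith
  | succ t ih =>
    obtain ⟨C, hC, N, hN⟩ := ih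
    set T := (t + 2) * (t + 2) * (ℓ + 1) + 1 with hT
    obtain ⟨C', hC'⟩ := exists_step_bound ℓ t T C hC
    have hk'N : ∀ᶠ k : ℕ in atTop, N ≤ ⌈√(Real.log k)⌉₊ + 1 := by
      have h : Tendsto (fun k : ℕ => √(Real.log k)) atTop atTop :=
        Real.tendsto_sqrt_atTop.comp (Real.tendsto_log_atTop.comp tendsto_natCast_atTop_atTop)
      filter_upwards [h.eventually_ge_atTop N] with k hk
      have := hk.trans (Nat.le_ceil _)
      have : N ≤ ⌈√(Real.log k)⌉₊ := by exact_mod_cast this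
      omega
    have hpos := ((tendsto_iteratedLog (t + 2)).comp
      tendsto_natCast_atTop_atTop).eventually_gt_atTop 0
    obtain ⟨N', hN'⟩ := eventually_atTop.1 (hC'.and (hk'N.and hpos))
    refine ⟨max C' 0, le_max_right _ _, max N' 1, fun k hk V _ F A hw hs hA => ?_⟩
    obtain ⟨hb, hNk', hIpos⟩ := hN' k ((le_max_left _ _).trans hk)
    set k' := ⌈√(Real.log k)⌉₊ + 1 with hk'
    obtain ⟨d, hd⟩ := F.exists_layering A
    set f := ⌊C * (Real.log k' / iteratedLog (t + 1) k')⌋₊ with hf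
    obtain ⟨φ, hφ, hlt⟩ := exists_isRank_step ℓ (t + 2) k (k' + 1) f ((Nat.log 2 k' + 1) * T) hd
      hw hA (by omega) (fun i A' hA' hl => by
        obtain ⟨φ, m, h1, h2, h3⟩ := hN k' hNk' F A' ((hd.widthLE hw i).subset hA')
          ((hd.isSimple (by omega) hw hs i).subset (hd.widthLE hw i) hA') hl
        exact ⟨φ, h1, fun v hv => (h2 v hv).trans_le (Nat.le_floor h3)⟩)
      (fun A' hA' hl => exists_isRank_log ℓ (t + 2) k' (hw.subset hA') hl)
    refine ⟨φ, _, hφ, fun v hv => (hlt v hv).trans_le (Nat.add_le_add_left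
      (Nat.mul_le_mul_left k' (show t + 2 ≤ T by rw [hT]; nlinarith)) _), ?_⟩
    refine (hb k' f rfl rfl).trans ?_
    refine mul_le_mul_of_nonneg_right (le_max_left _ _) (div_nonneg ?_ hIpos.le)
    exact Real.log_natCast_nonneg k

end ElimForest

/-! ### From tree decompositions to forest orders -/

namespace SimpleGraph

/-- A tree can be rooted: each edge joins a node to its parent, and parents are closer to the root
(the root is its own parent). -/
theorem IsTree.exists_parent {ι : Type*} {T : SimpleGraph ι} (hT : T.IsTree) :
    ∃ (f : ι → ι) (depth : ι → ℕ), (∀ x y, T.Adj x y → f x = y ∨ f y = x) ∧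
      ∀ x, f x = x ∨ depth (f x) < depth x := by
  classical
  obtain ⟨r⟩ := hT.connected.nonempty
  choose p hp hlen using fun x => (hT.connected r x).exists_path_of_dist
  have hstep : ∀ x y, T.Adj x y → T.dist r x = T.dist r y + 1 → (p x).penultimate = y := by
    intro x y hxy hd
    refine (hT.isAcyclic.eq_penultimate_of_adj_end (hp x) hxy ?_).symm
    refine hT.isAcyclic.mem_support_of_ne_mem_support_of_adj_of_isPath (hp x) (hp y) hxy
      fun hx => ?_
    have h1 := congrArg Walk.length (hT.isAcyclic.path_concat (hp x) (hp y) hxy hx)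
    rw [Walk.length_concat, hlen, hlen] at h1
    omega
  refine ⟨fun x => (p x).penultimate, T.dist r, fun x y hxy => ?_, fun x => ?_⟩
  · rcases hT.dist_eq_dist_add_one_of_adj r hxy with h | h
    · exact .inl (hstep x y hxy h)
    · exact .inr (hstep y x hxy.symm h)
  · by_cases hn : (p x).Nil
    · left
      show (p x).penultimate = x
      generalize p x = q at hn ⊢
      cases q with
      | nil => rfl
      | cons h q => simp at hn
    · right
      have hadj := (p x).adj_penultimate hn
      have h1 : T.dist r (p x).penultimate ≤ _ := dist_le (p x).dropLast
      have h2 := hlen x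
      have h3 := Walk.length_dropLast_add_one hn
      show T.dist r (p x).penultimate < T.dist r x
      omega

/-- `Below f z y`: the node `z` is an ancestor of `y` (or equal to it) for the parent map `f`. -/
def Below {ι : Type*} (f : ι → ι) (z y : ι) : Prop := ∃ k, f^[k] y = z

namespace Below

variable {ι : Type*} {f : ι → ι} {x y z : ι}

theorem refl (x : ι) : Below f x x := ⟨0, rfl⟩

theorem trans (h : Below f x y) (h' : Below f y z) : Below f x z := by
  obtain ⟨k, rfl⟩ := h
  obtain ⟨l, rfl⟩ := h'
  exact ⟨k + l, Function.iterate_add_apply f k l z⟩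

theorem total (h : Below f x z) (h' : Below f y z) : Below f x y ∨ Below f y x := by
  obtain ⟨k, rfl⟩ := h
  obtain ⟨l, rfl⟩ := h'
  rcases le_total k l with hkl | hkl
  · right; exact ⟨l - k, by rw [← Function.iterate_add_apply, Nat.sub_add_cancel hkl]⟩
  · left; exact ⟨k - l, by rw [← Function.iterate_add_apply, Nat.sub_add_cancel hkl]⟩

theorem eq_or_depth_lt {depth : ι → ℕ} (hf : ∀ x, f x = x ∨ depth (f x) < depth x)
    (h : Below f x y) : x = y ∨ depth x < depth y := by
  obtain ⟨k, rfl⟩ := h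
  induction k with
  | zero => exact .inl rfl
  | succ k ih =>
    rw [Function.iterate_succ_apply']
    rcases hf (f^[k] y) with h | h
    · rw [h]; exact ih
    · right
      rcases ih with h' | h'
      · rw [h'] at h ⊢; exact h
      · omega

theorem antisymm {depth : ι → ℕ} (hf : ∀ x, f x = x ∨ depth (f x) < depth x)
    (h : Below f x y) (h' : Below f y x) : x = y := by
  rcases h.eq_or_depth_lt hf with h | h
  · exact h
  · rcases h'.eq_or_depth_lt hf with h' | h'
    · exact h'.symm
    · omega

end Below

/-- A connected set of nodes of a rooted tree has a top node and is convex. -/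
theorem exists_top {ι : Type*} {T : SimpleGraph ι} {f : ι → ι} {depth : ι → ℕ}
    (hadj : ∀ x y, T.Adj x y → f x = y ∨ f y = x) (hf : ∀ x, f x = x ∨ depth (f x) < depth x)
    {X : Set ι} (hX : (T.induce X).Connected) :
    ∃ r ∈ X, ∀ x ∈ X, Below f r x ∧ ∀ z, Below f r z → Below f z x → z ∈ X := by
  obtain ⟨⟨x₀, hx₀⟩⟩ := hX.nonempty
  obtain ⟨r, hr, hmin⟩ := (measure depth).wf.has_min X ⟨x₀, hx₀⟩
  refine ⟨r, hr, fun x hx => ?_⟩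
  have hreach := (reachable_iff_reflTransGen _ _).1 (hX ⟨r, hr⟩ ⟨x, hx⟩)
  suffices ∀ y : X, Relation.ReflTransGen (T.induce X).Adj ⟨r, hr⟩ y →
      Below f r y ∧ ∀ z, Below f r z → Below f z y → z ∈ X from this ⟨x, hx⟩ hreach
  intro y hy
  induction hy with
  | refl =>
    exact ⟨.refl r, fun z h1 h2 => by rw [h2.antisymm hf h1]; exact hr⟩
  | @tail x y _ hxy ih =>
    obtain ⟨x, hx⟩ := x
    obtain ⟨y, hy⟩ := y
    obtain ⟨ih1, ih2⟩ := ih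
    have hxy' : T.Adj x y := hxy
    rcases hadj x y hxy' with h | h
    · have hyx : Below f y x := ⟨1, h⟩
      refine ⟨?_, fun z h1 h2 => ih2 z h1 (h2.trans hyx)⟩
      obtain ⟨k, hk⟩ := ih1
      cases k with
      | zero =>
        have hxr : x = r := hk
        subst hxr
        rcases hf x with h' | h'
        · exact (hxy'.ne (h'.symm.trans h)).elim
        · rw [h] at h'; exact (hmin y hy h').elim
      | succ k => exact ⟨k, h ▸ hk⟩
    · refine ⟨ih1.trans ⟨1, h⟩, fun z h1 h2 => ?_⟩
      obtain ⟨k, hk⟩ := h2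
      cases k with
      | zero => rw [← hk]; exact hy
      | succ k => exact ih2 z h1 ⟨k, h ▸ hk⟩

/-- Root the tree of a tree decomposition and order the vertices by the top nodes of their subtrees,
with ties broken arbitrarily; `E u v` holds if `u` is an ancestor of `v` in the top bag of `v`. This
gives a forest-ordered chordal graph that contains `G`. -/
theorem TreeDecomposition.exists_elimForest {V ι : Type*} [Finite V] {G : SimpleGraph V}
    (D : G.TreeDecomposition ι) :
    ∃ (_ : PartialOrder V) (F : ElimForest V) (top : V → ι), (∀ u v, G.Adj u v → F.Adj u v) ∧
      (∀ u v, F.E u v → u ∈ D.bag (top v)) ∧ (∀ v, v ∈ D.bag (top v)) ∧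
      ∀ u v, top u = top v → u ≤ v ∨ v ≤ u := by
  obtain ⟨f, depth, hadj, hf⟩ := D.isTree.exists_parent
  choose top htop hbelow using fun v => exists_top hadj hf (D.connected v)
  obtain ⟨e, he⟩ := Countable.exists_injective_nat V
  let P : PartialOrder V :=
    { le := fun u v => Below f (top u) (top v) ∧ (top u = top v → e u ≤ e v)
      le_refl := fun u => ⟨.refl _, fun _ => le_rfl⟩
      le_trans := fun u v w h h' => ⟨h.1.trans h'.1, fun huw => by
        have huv : top u = top v := h.1.antisymm hf (huw ▸ h'.1)
        exact (h.2 huv).trans (h'.2 (huv.symm.trans huw))⟩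
      le_antisymm := fun u v h h' => by
        have huv : top u = top v := h.1.antisymm hf h'.1
        exact he (le_antisymm (h.2 huv) (h'.2 huv.symm)) }
  have hle : ∀ u v, u ≤ v ↔ Below f (top u) (top v) ∧ (top u = top v → e u ≤ e v) :=
    fun _ _ => Iff.rfl
  have htotal : ∀ u v x, Below f (top u) x → Below f (top v) x → u ≤ v ∨ v ≤ u := by
    intro u v x h h'
    by_cases huv : top u = top v
    · rcases le_total (e u) (e v) with h1 | h1
      · exact .inl ⟨huv ▸ .refl _, fun _ => h1⟩
      · exact .inr ⟨huv ▸ .refl _, fun _ => h1⟩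
    · exact (h.total h').imp (fun h => ⟨h, fun e => (huv e).elim⟩)
        fun h => ⟨h, fun e => (huv e.symm).elim⟩
  let F : ElimForest V :=
    { E := fun u v => u < v ∧ u ∈ D.bag (top v)
      comparable := fun {u v w} h h' => htotal u v (top w) h.1 h'.1
      lt_of_E := fun h => h.1
      E_of_E := fun {u v w} h h1 h2 => ⟨h1, (hbelow u _ h.2).2 _ h1.le.1 h2.1⟩ }
  refine ⟨P, F, top, fun u v huv => ?_, fun u v h => h.2, htop, fun u v h => ?_⟩
  · obtain ⟨x, hux, hvx⟩ := D.edge_mem u v huv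
    have h1 := (hbelow u x hux).1
    have h2 := (hbelow v x hvx).1
    rcases htotal u v x h1 h2 with h | h
    · exact .inl ⟨h.lt_of_ne huv.ne, (hbelow u x hux).2 _ h.1 h2⟩
    · exact .inr ⟨h.lt_of_ne huv.ne', (hbelow v x hvx).2 _ h.1 h1⟩
  · exact htotal u v (top u) (.refl _) (h ▸ .refl _)

theorem TreeDecomposition.card_bag_le {V ι : Type*} [Fintype ι] {G : SimpleGraph V}
    (D : G.TreeDecomposition ι) {t : ℕ} (h : D.width ≤ t) (x : ι) : (D.bag x).card ≤ t + 1 := by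
  have h1 : (D.bag x).card ≤ Finset.univ.sup fun x => (D.bag x).card :=
    Finset.le_sup (f := fun x => (D.bag x).card) (Finset.mem_univ x)
  unfold width at h
  omega

/-- A clique lies in the top bag of its last vertex. -/
theorem TreeDecomposition.clique_card_le {V ι : Type*} [Finite V] [Fintype ι]
    {G : SimpleGraph V} (D : G.TreeDecomposition ι) {C : Finset V} (hC : G.IsClique C) :
    (C.card : ℤ) ≤ D.width + 1 := by
  rcases C.eq_empty_or_nonempty with rfl | hne
  · simp [width]
  obtain ⟨_, F, top, hGF, hE, hv, -⟩ := D.exists_elimForest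
  obtain ⟨m, hm⟩ := C.exists_maximal hne
  have hsub : C ⊆ D.bag (top m) := by
    intro u hu
    by_cases hum : u = m
    · rw [hum]; exact hv m
    · rcases hGF u m (hC hu hm.1 hum) with h | h
      · exact hE u m h
      · exact absurd (hm.2 hu (F.lt_of_E h).le) (F.lt_of_E h).not_ge
  have h1 := Finset.card_le_card hsub
  have h2 : (D.bag (top m)).card ≤ Finset.univ.sup fun x => (D.bag x).card :=
    Finset.le_sup (f := fun x => (D.bag x).card) (Finset.mem_univ _)
  unfold width
  omega

/-- The forest order of an `s`-simple tree decomposition is simple of any width `t ≥ s`; for `t > s`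
there are no vertices with `t` adjacent ancestors. -/
theorem HasSimpleTreeDecomposition.exists_elimForest {V : Type*} [Fintype V] {G : SimpleGraph V}
    {s t : ℕ} (hG : G.HasSimpleTreeDecomposition s) (hst : s ≤ t) :
    ∃ (_ : PartialOrder V) (F : ElimForest V), (∀ u v, G.Adj u v → F.Adj u v) ∧
      F.WidthLE Finset.univ t ∧ F.IsSimple Finset.univ t := by
  classical
  obtain ⟨ι, _, D, hw, hs⟩ := hG
  obtain ⟨P, F, top, hGF, hE, hv, htop⟩ := D.exists_elimForest
  have hsub : ∀ v, insert v (F.back Finset.univ v) ⊆ D.bag (top v) := fun v =>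
    Finset.insert_subset (hv v) fun u hu => hE u v (ElimForest.mem_back.1 hu).2
  have hcard : ∀ v, (insert v (F.back Finset.univ v)).card = (F.back Finset.univ v).card + 1 :=
    fun v => Finset.card_insert_of_notMem fun h =>
      lt_irrefl _ (F.lt_of_E (ElimForest.mem_back.1 h).2)
  have hbag := D.card_bag_le hw.le
  have hwidth : ∀ v, (F.back Finset.univ v).card ≤ s := by
    intro v
    have := (Finset.card_le_card (hsub v)).trans (hbag (top v))
    rw [hcard] at this
    omega
  refine ⟨P, F, hGF, fun v _ => (hwidth v).trans hst, fun S _ hSc => ?_⟩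
  set T := Finset.univ.filter fun v => (F.back Finset.univ v).card = t ∧
    S ⊆ insert v (F.back Finset.univ v)
  rcases T.eq_empty_or_nonempty with h0 | ⟨v₀, hv₀⟩
  · simp [h0]
  have hts : t = s := by
    have h1 := (Finset.mem_filter.1 hv₀).2.1
    have h2 := hwidth v₀
    omega
  subst hts
  have hbag_eq : ∀ v ∈ T, insert v (F.back Finset.univ v) = D.bag (top v) := fun v hvT =>
    Finset.eq_of_subset_of_card_le (hsub v) (by
      rw [hcard, (Finset.mem_filter.1 hvT).2.1]; exact hbag _)
  have hinj : Set.InjOn top (T : Set V) := by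
    intro u hu v hvT huv
    rcases htop u v huv with h | h
    · by_contra hne
      have h1 : v ∈ insert u (F.back Finset.univ u) := by
        rw [hbag_eq u hu, huv]; exact hv v
      rcases Finset.mem_insert.1 h1 with h2 | h2
      · exact hne h2.symm
      · exact (F.lt_of_E (ElimForest.mem_back.1 h2).2).not_ge h
    · by_contra hne
      have h1 : u ∈ insert v (F.back Finset.univ v) := by
        rw [hbag_eq v hvT, ← huv]; exact hv u
      rcases Finset.mem_insert.1 h1 with h2 | h2
      · exact hne h2
      · exact (F.lt_of_E (ElimForest.mem_back.1 h2).2).not_ge h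
  rw [← Set.ncard_coe_finset]
  refine (Set.ncard_le_ncard_of_injOn top (fun v hvT => ?_) hinj (Set.toFinite _)).trans (hs S hSc)
  show S ⊆ D.bag (top v)
  rw [← hbag_eq v hvT]
  exact (Finset.mem_filter.1 hvT).2.2

/-! ### The upper bound -/

theorem rankingNumber_le_of_isRank {V : Type*} [Fintype V] [PartialOrder V] {F : ElimForest V}
    {G : SimpleGraph V} (hGF : ∀ u v, G.Adj u v → F.Adj u v) {ℓ m : ℕ} {φ : V → ℕ}
    (hφ : F.IsRank ℓ Finset.univ φ) (hlt : ∀ v, φ v < m) : G.rankingNumber ℓ ≤ m := by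
  refine Nat.sInf_le ⟨fun v => φ v + 1, fun u v p hp h1 hpl => ?_, fun v => ?_⟩
  · by_contra! hcon
    obtain ⟨heq, hmax⟩ := hcon
    have hjoin : ∀ {a b : V} (q : G.Walk a b), (∀ w ∈ q.support, φ w ≤ φ u) →
        ∀ n, q.length ≤ n → F.Joined {x | x ∈ Finset.univ ∧ φ x ≤ φ u} n a b := by
      intro a b q
      induction q with
      | nil => exact fun hq n _ => .refl n ⟨Finset.mem_univ _, hq _ (by simp)⟩
      | cons h q ih =>
        intro hq n hn
        rw [Walk.length_cons] at hn
        obtain ⟨n, rfl⟩ : ∃ k, n = k + 1 := ⟨n - 1, by omega⟩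
        exact .step ⟨Finset.mem_univ _, hq _ (by simp)⟩ (hGF _ _ h)
          (ih (fun w hw => hq w (by simp [hw])) n (by omega))
    have huv : u = v := hφ u (Finset.mem_univ _) v (Finset.mem_univ _) (by omega)
      (hjoin p (fun w hw => by have := hmax w hw; omega) ℓ hpl)
    subst huv
    have : p.length = 0 := Walk.length_eq_zero_iff.2 (Walk.isPath_iff_nil.1 hp)
    omega
  · have := hlt v
    simp only [Finset.mem_Icc]
    omega

theorem exists_rankingNumber_le (ℓ t : ℕ) (ht : 1 ≤ t) : ∃ (C : ℝ) (N : ℕ), ∀ n : ℕ, N ≤ n →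
    ∀ (V : Type*) [Fintype V] (H : SimpleGraph V), Fintype.card V = n →
      H.simpleTreewidth ≤ t → (H.rankingNumber ℓ : ℝ) ≤ C * (Real.log n / iteratedLog t n) := by
  obtain ⟨t, rfl⟩ : ∃ s, t = s + 1 := ⟨t - 1, by omega⟩
  obtain ⟨C, -, N, hN⟩ := ElimForest.exists_isRank_iteratedLog ℓ t
  refine ⟨C, max N 1, fun n hn V _ H hcard hH => ?_⟩
  have hne : Nonempty V := Fintype.card_pos_iff.1 (by omega)
  have hmem := Nat.sInf_mem (exists_simpleTreeDecomposition H)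
  obtain ⟨P, F, hGF, hw, hs⟩ := HasSimpleTreeDecomposition.exists_elimForest hmem hH
  obtain ⟨φ, m, hφ, hlt, hm⟩ := hN n ((le_max_left _ _).trans hn) F Finset.univ hw hs
    (fun v _ W _ _ _ => hcard ▸ Finset.card_le_univ W)
  refine le_trans ?_ hm
  exact_mod_cast rankingNumber_le_of_isRank hGF hφ fun v => hlt v (Finset.mem_univ v)

end SimpleGraph

/-! ### Constructing simple tree decompositions -/

/-- A rooted simple tree decomposition of width at most `t` whose nodes are the vertices themselves:
the bag of `v` consists of `v` and of the set `back v` of its adjacent predecessors, which belongs to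
the bag of the parent of `v`. -/
structure BagTree (V : Type*) [DecidableEq V] (t : ℕ) where
  /-- the root -/
  root : V
  /-- the parent of a vertex; irrelevant at the root -/
  parent : V → V
  /-- a rank that increases from predecessors to successors -/
  pos : V → ℕ
  /-- the adjacent predecessors of a vertex -/
  back : V → Finset V
  back_root : back root = ∅
  parent_mem : ∀ v, v ≠ root → parent v ∈ back v
  back_subset : ∀ v, v ≠ root → back v ⊆ insert (parent v) (back (parent v))
  pos_lt : ∀ u v, u ∈ back v → pos u < pos v
  card_le : ∀ v, (back v).card ≤ t
  simple : ∀ S : Finset V, S.card = t → {v | S ⊆ insert v (back v)}.ncard ≤ 2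

namespace BagTree

variable {V : Type*} [DecidableEq V] {t : ℕ} (T : BagTree V t)

/-- The bag of a vertex. -/
def bag (v : V) : Finset V := insert v (T.back v)

/-- The chordal graph described by the decomposition. -/
def graph : SimpleGraph V where
  Adj u v := u ∈ T.back v ∨ v ∈ T.back u
  symm := ⟨fun _ _ h => h.symm⟩
  loopless := ⟨fun v h => by rcases h with h | h <;> exact lt_irrefl _ (T.pos_lt v v h)⟩

/-- The tree that joins each vertex to its parent. -/
def tree : SimpleGraph V where
  Adj u v := (u ≠ T.root ∧ T.parent u = v) ∨ (v ≠ T.root ∧ T.parent v = u)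
  symm := ⟨fun _ _ h => h.symm⟩
  loopless := ⟨fun v h => by
    rcases h with ⟨h, h'⟩ | ⟨h, h'⟩ <;>
    · have := T.pos_lt _ _ (T.parent_mem v h)
      rw [h'] at this
      exact lt_irrefl _ this⟩

theorem tree_adj_parent {v : V} (hv : v ≠ T.root) : T.tree.Adj v (T.parent v) := .inl ⟨hv, rfl⟩

theorem pos_parent_lt {v : V} (hv : v ≠ T.root) : T.pos (T.parent v) < T.pos v :=
  T.pos_lt _ _ (T.parent_mem v hv)

theorem tree_connected : T.tree.Connected := by
  refine (SimpleGraph.connected_iff_exists_forall_reachable _).2 ⟨T.root, fun v => ?_⟩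
  induction hn : T.pos v using Nat.strong_induction_on generalizing v with
  | _ n ih =>
    by_cases hv : v = T.root
    · rw [hv]
    · exact (ih _ (hn ▸ T.pos_parent_lt hv) _ rfl).trans (T.tree_adj_parent hv).reachable.symm

theorem tree_isTree [Finite V] : T.tree.IsTree := by
  classical
  have := Fintype.ofFinite V
  refine SimpleGraph.isTree_iff_connected_and_card.2 ⟨T.tree_connected, le_antisymm ?_
    T.tree_connected.card_vert_le_card_edgeSet_add_one⟩
  have hsub : T.tree.edgeSet ⊆ (fun v => s(v, T.parent v)) '' {v | v ≠ T.root} := by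
    intro e
    induction e with
    | _ u v =>
      rintro (⟨h, h'⟩ | ⟨h, h'⟩)
      · exact ⟨u, h, congrArg (fun x => s(u, x)) h'⟩
      · exact ⟨v, h, (congrArg (fun x => s(v, x)) h').trans Sym2.eq_swap⟩
  have h1 : T.tree.edgeSet.ncard ≤ {v | v ≠ T.root}.ncard :=
    (Set.ncard_le_ncard hsub (Set.toFinite _)).trans (Set.ncard_image_le (Set.toFinite _))
  have h2 : {v | v ≠ T.root}.ncard + 1 = Nat.card V := by
    have h3 : {v | v ≠ T.root} = {T.root}ᶜ := rfl
    rw [h3]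
    have := Set.ncard_add_ncard_compl {T.root}
    rw [Set.ncard_singleton] at this
    omega
  rw [← h2]
  exact Nat.succ_le_succ h1

/-- The tree decomposition described by a `BagTree`. -/
def decomposition [Finite V] : T.graph.TreeDecomposition V where
  tree := T.tree
  isTree := T.tree_isTree
  bag := T.bag
  connected v := by
    refine (SimpleGraph.connected_iff_exists_forall_reachable _).2
      ⟨⟨v, Finset.mem_insert_self _ _⟩, ?_⟩
    rintro ⟨x, hx⟩
    induction hn : T.pos x using Nat.strong_induction_on generalizing x with
    | _ n ih =>
      rcases Finset.mem_insert.1 hx with h | h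
      · subst h; rfl
      · have hxr : x ≠ T.root := by
          rintro rfl
          rw [T.back_root] at h
          exact Finset.notMem_empty _ h
        have hp : v ∈ T.bag (T.parent x) := T.back_subset x hxr h
        refine (ih _ (hn ▸ T.pos_parent_lt hxr) _ hp rfl).trans
          (SimpleGraph.Adj.reachable (SimpleGraph.Adj.symm ?_))
        exact T.tree_adj_parent hxr
  edge_mem u v h := by
    rcases h with h | h
    · exact ⟨v, Finset.mem_insert_of_mem h, Finset.mem_insert_self _ _⟩
    · exact ⟨u, Finset.mem_insert_self _ _, Finset.mem_insert_of_mem h⟩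

/-- A clique with `t + 1` vertices forces the simple treewidth to be exactly `t`. -/
theorem simpleTreewidth_eq {V : Type} [Fintype V] [DecidableEq V] (T : BagTree V t)
    {C : Finset V} (hC : T.graph.IsClique C) (hCt : C.card = t + 1) :
    T.graph.simpleTreewidth = t := by
  have hmem : T.graph.HasSimpleTreeDecomposition t := by
    refine ⟨V, inferInstance, T.decomposition, le_antisymm ?_ ?_, T.simple⟩
    · have : (Finset.univ.sup fun x => (T.decomposition.bag x).card) ≤ t + 1 :=
        Finset.sup_le fun x _ => (Finset.card_insert_le _ _).trans
          (Nat.add_le_add_right (T.card_le x) 1)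
      unfold SimpleGraph.TreeDecomposition.width
      omega
    · have := T.decomposition.clique_card_le hC
      omega
  refine le_antisymm (Nat.sInf_le hmem) (le_csInf ⟨t, hmem⟩ ?_)
  rintro s ⟨ι, _, D, hw, -⟩
  have := D.clique_card_le hC
  omega

/-- One vertex. -/
def single (t : ℕ) : BagTree Unit t where
  root := ()
  parent := id
  pos _ := 0
  back _ := ∅
  back_root := rfl
  parent_mem v h := (h rfl).elim
  back_subset v h := (h rfl).elim
  pos_lt := by simp
  card_le := by simp
  simple S _ := (Set.ncard_le_one_of_subsingleton _).trans one_le_two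

/-- The predecessor on the path `0, …, n`. -/
def pathParent {n : ℕ} (i : Fin (n + 1)) : Fin (n + 1) := ⟨(i : ℕ) - 1, by omega⟩

/-- A path. -/
def path (n : ℕ) : BagTree (Fin (n + 1)) 1 where
  root := 0
  parent := pathParent
  pos i := i
  back i := if i = 0 then ∅ else {pathParent i}
  back_root := if_pos rfl
  parent_mem v h := by simp [h]
  back_subset v h := by simp [h]
  pos_lt u v h := by
    by_cases hv : v = 0
    · simp [hv] at h
    · have : (v : ℕ) ≠ 0 := fun e => hv (Fin.ext e)
      simp only [hv, if_false, Finset.mem_singleton] at h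
      rw [h]; show (v : ℕ) - 1 < v; omega
  card_le v := by split_ifs <;> simp
  simple S hS := by
    obtain ⟨s, rfl⟩ := Finset.card_eq_one.1 hS
    refine le_trans (Set.ncard_le_ncard_of_injOn Fin.val (t := {(s : ℕ), (s : ℕ) + 1}) ?_
      Fin.val_injective.injOn (Set.toFinite _)) ((Set.ncard_insert_le _ _).trans
        (by rw [Set.ncard_singleton]))
    intro v hv
    have hv' : s = v ∨ s ∈ (if v = 0 then ∅ else {pathParent v} : Finset (Fin (n + 1))) := by
      simpa using hv
    rcases hv' with h | h
    · exact .inl (h ▸ rfl)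
    · by_cases hv0 : v = 0
      · simp [hv0] at h
      · have : (v : ℕ) ≠ 0 := fun e => hv0 (Fin.ext e)
        simp only [hv0, if_false, Finset.mem_singleton] at h
        right
        rw [h]; show (v : ℕ) = (v : ℕ) - 1 + 1; omega

/-! ### The recursive construction for the lower bound -/

section Cone

variable {U W : Type} [DecidableEq U] [DecidableEq W] {s : ℕ}

/-- The adjacent predecessors in the construction `cone`. -/
def coneBack (m : ℕ) (Q : BagTree U s) (G : BagTree W (s + 1)) :
    Option ((Fin m × U) × W) → Finset (Option ((Fin m × U) × W))
  | none => ∅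
  | some ((c, q), w) =>
    if w = G.root then insert none ((Q.back q).image fun q' => some ((c, q'), G.root))
    else (G.back w).image fun w' => some ((c, q), w')

/-- The parents in the construction `cone`. -/
def coneParent (m : ℕ) (Q : BagTree U s) (G : BagTree W (s + 1)) :
    Option ((Fin m × U) × W) → Option ((Fin m × U) × W)
  | none => none
  | some ((c, q), w) =>
    if w = G.root then (if q = Q.root then none else some ((c, Q.parent q), G.root))
    else some ((c, q), G.parent w)

/-- The ranks in the construction `cone`. -/
def conePos (m : ℕ) (Q : BagTree U s) (G : BagTree W (s + 1)) : Option ((Fin m × U) × W) → ℕ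
  | none => 0
  | some ((_, q), w) => 1 + Q.pos q + G.pos w

variable {m : ℕ} {Q : BagTree U s} {G : BagTree W (s + 1)}

theorem mem_coneBag_root {x : Option ((Fin m × U) × W)} {c : Fin m} {q : U} :
    x ∈ insert (some ((c, q), G.root)) (coneBack m Q G (some ((c, q), G.root))) ↔
      x = none ∨ ∃ q' ∈ Q.bag q, x = some ((c, q'), G.root) := by
  simp only [coneBack, if_pos, bag, Finset.mem_insert, Finset.mem_image]
  constructor
  · rintro (rfl | rfl | ⟨q', h, rfl⟩)
    · exact .inr ⟨q, .inl rfl, rfl⟩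
    · exact .inl rfl
    · exact .inr ⟨q', .inr h, rfl⟩
  · rintro (rfl | ⟨q', rfl | h, rfl⟩)
    · exact .inr (.inl rfl)
    · exact .inl rfl
    · exact .inr (.inr ⟨q', h, rfl⟩)

theorem mem_coneBag_inner {x : Option ((Fin m × U) × W)} {c : Fin m} {q : U} {w : W}
    (hw : w ≠ G.root) :
    x ∈ insert (some ((c, q), w)) (coneBack m Q G (some ((c, q), w))) ↔
      ∃ w' ∈ G.bag w, x = some ((c, q), w') := by
  simp only [coneBack, if_neg hw, bag, Finset.mem_insert, Finset.mem_image]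
  constructor
  · rintro (rfl | ⟨w', h, rfl⟩)
    · exact ⟨w, .inl rfl, rfl⟩
    · exact ⟨w', .inr h, rfl⟩
  · rintro ⟨w', rfl | h, rfl⟩
    · exact .inl rfl
    · exact .inr ⟨w', h, rfl⟩

/-- A set of at least two vertices that lies in bags of the cone lies in bags of one copy of `G`, or,
up to the apex, in bags of one copy of `Q`. -/
theorem cone_simple [Finite U] [Finite W] (hs : 1 ≤ s) (S : Finset (Option ((Fin m × U) × W)))
    (hS : S.card = s + 1) :
    {v | S ⊆ insert v (coneBack m Q G v)}.ncard ≤ 2 := by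
  have key : ∀ {α : Type} [Finite α] (h : α → Option ((Fin m × U) × W)) (X : Set α),
      X.ncard ≤ 2 → {v | S ⊆ insert v (coneBack m Q G v)} ⊆ h '' X →
      {v | S ⊆ insert v (coneBack m Q G v)}.ncard ≤ 2 := fun h X hX hsub =>
    (Set.ncard_le_ncard hsub (Set.toFinite _)).trans ((Set.ncard_image_le (Set.toFinite _)).trans hX)
  have hle1 : ∀ x, ¬ S ⊆ {x} := fun x h => by
    have := Finset.card_le_card h
    rw [Finset.card_singleton] at this
    omega
  by_cases hA : ∃ c q g, g ≠ G.root ∧ some ((c, q), g) ∈ S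
  · obtain ⟨c, q, g, hg, hgS⟩ := hA
    -- such a set lies in the copy of `G` with index `(c, q)`
    have hinv : ∀ v, S ⊆ insert v (coneBack m Q G v) → ∃ w, v = some ((c, q), w) ∧
        ∀ x ∈ S, ∃ w' ∈ G.bag w, x = some ((c, q), w') := by
      intro v hv
      have h1 := hv hgS
      rcases v with _ | ⟨⟨c', q'⟩, w⟩
      · simp [coneBack] at h1
      · by_cases hw : w = G.root
        · subst hw
          rw [mem_coneBag_root] at h1
          rcases h1 with h1 | ⟨q'', -, h1⟩
          · simp at h1
          · simp only [Option.some.injEq, Prod.mk.injEq] at h1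
            exact (hg h1.2).elim
        · obtain ⟨w', -, h2⟩ := (mem_coneBag_inner hw).1 h1
          simp only [Option.some.injEq, Prod.mk.injEq] at h2
          obtain ⟨⟨rfl, rfl⟩, -⟩ := h2
          exact ⟨w, rfl, fun x hx => (mem_coneBag_inner hw).1 (hv hx)⟩
    rcases Set.eq_empty_or_nonempty {v | S ⊆ insert v (coneBack m Q G v)} with h0 | ⟨v₀, hv₀⟩
    · rw [h0]; simp
    obtain ⟨w₀, -, hw₀⟩ := hinv v₀ hv₀
    let i : W → Option ((Fin m × U) × W) := fun w => some ((c, q), w)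
    have hi : Function.Injective i := fun a b h => by
      simpa [i] using h
    set S' := S.preimage i hi.injOn with hS'
    have hSS' : S'.image i = S := by
      ext x
      simp only [S', Finset.mem_image, Finset.mem_preimage]
      refine ⟨by rintro ⟨a, h, rfl⟩; exact h, fun hx => ?_⟩
      obtain ⟨w', -, rfl⟩ := hw₀ x hx
      exact ⟨w', hx, rfl⟩
    have hc : S'.card = s + 1 := by
      rw [← hS, ← hSS', Finset.card_image_of_injective _ hi]
    refine key i {w : W | S' ⊆ insert w (G.back w)} (G.simple S' hc) fun v hv => ?_
    obtain ⟨w, rfl, hw⟩ := hinv v hv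
    refine ⟨w, fun a ha => ?_, rfl⟩
    obtain ⟨w', hw', h⟩ := hw (i a) (Finset.mem_preimage.1 ha)
    rw [hi h]
    exact hw'
  · push Not at hA
    obtain ⟨x₀, hx₀, hx₀n⟩ : ∃ x ∈ S, x ≠ none := by
      by_contra! h
      exact hle1 none fun x hx => by rw [h x hx]; simp
    rcases x₀ with _ | ⟨⟨c, q₀⟩, g⟩
    · exact (hx₀n rfl).elim
    have hroot : ∀ v, S ⊆ insert v (coneBack m Q G v) → ∃ q, v = some ((c, q), G.root) ∧
        ∀ x ∈ S, x = none ∨ ∃ q' ∈ Q.bag q, x = some ((c, q'), G.root) := by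
      intro v hv
      rcases v with _ | ⟨⟨c', q⟩, w⟩
      · exact (hle1 none (by simpa [coneBack] using hv)).elim
      · by_cases hw : w = G.root
        · subst hw
          have h1 := mem_coneBag_root.1 (hv hx₀)
          rcases h1 with h1 | ⟨q', -, h1⟩
          · simp at h1
          · simp only [Option.some.injEq, Prod.mk.injEq] at h1
            obtain ⟨⟨rfl, -⟩, -⟩ := h1
            exact ⟨q, rfl, fun x hx => mem_coneBag_root.1 (hv hx)⟩
        · refine (hle1 (some ((c', q), G.root)) fun x hx => ?_).elim
          obtain ⟨w', -, rfl⟩ := (mem_coneBag_inner hw).1 (hv hx)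
          by_cases hw' : w' = G.root
          · simp [hw']
          · exact (hA c' q w' hw' hx).elim
    rcases Set.eq_empty_or_nonempty {v | S ⊆ insert v (coneBack m Q G v)} with h0 | ⟨v₀, hv₀⟩
    · rw [h0]; simp
    obtain ⟨_, _, hq₀⟩ := hroot v₀ hv₀
    let i : U → Option ((Fin m × U) × W) := fun q => some ((c, q), G.root)
    have hi : Function.Injective i := fun a b h => by
      simpa [i] using h
    set S' := S.preimage i hi.injOn with hS'
    have hSS' : S ⊆ insert none (S'.image i) := by
      intro x hx
      rcases hq₀ x hx with rfl | ⟨q', -, rfl⟩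
      · exact Finset.mem_insert_self _ _
      · exact Finset.mem_insert_of_mem (Finset.mem_image.2 ⟨q', Finset.mem_preimage.2 hx, rfl⟩)
    have hc : s ≤ S'.card := by
      have h1 := (Finset.card_le_card hSS').trans (Finset.card_insert_le _ _)
      rw [Finset.card_image_of_injective _ hi, hS] at h1
      omega
    obtain ⟨S'', hsub, hS''⟩ := Finset.exists_subset_card_eq hc
    refine key i {q : U | S'' ⊆ insert q (Q.back q)} (Q.simple S'' hS'') fun v hv => ?_
    obtain ⟨q, rfl, hq⟩ := hroot v hv
    refine ⟨q, fun a ha => ?_, rfl⟩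
    rcases hq (i a) (Finset.mem_preimage.1 (hsub ha)) with h | ⟨q', hq', h⟩
    · simp [i] at h
    · rw [hi h]
      exact hq'

/-- The recursive construction: a new vertex `none`, the apex, is joined to all vertices of `m`
disjoint copies of `Q`, and each of these vertices is made the root of a copy of `G` of its own. The
vertex `some ((c, q), w)` is the copy of `w` that hangs at the copy of `q` in the `c`-th copy
of `Q`. -/
def cone [Finite U] [Finite W] (hs : 1 ≤ s) (m : ℕ) (Q : BagTree U s) (G : BagTree W (s + 1)) :
    BagTree (Option ((Fin m × U) × W)) (s + 1) where
  root := none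
  parent := coneParent m Q G
  pos := conePos m Q G
  back := coneBack m Q G
  back_root := rfl
  parent_mem v hv := by
    rcases v with _ | ⟨⟨c, q⟩, w⟩
    · exact (hv rfl).elim
    · by_cases hw : w = G.root
      · by_cases hq : q = Q.root
        · simp [coneBack, coneParent, hw, hq]
        · simp only [coneBack, coneParent, hw, hq, if_true, if_false]
          exact Finset.mem_insert_of_mem (Finset.mem_image_of_mem _ (Q.parent_mem q hq))
      · simp only [coneBack, coneParent, hw, if_false]
        exact Finset.mem_image_of_mem _ (G.parent_mem w hw)
  back_subset v hv := by
    rcases v with _ | ⟨⟨c, q⟩, w⟩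
    · exact (hv rfl).elim
    · by_cases hw : w = G.root
      · subst hw
        by_cases hq : q = Q.root
        · simp [coneBack, coneParent, hq, Q.back_root]
        · intro x hx
          simp only [coneParent, hq, if_true, if_false]
          rw [mem_coneBag_root]
          simp only [coneBack, if_true, Finset.mem_insert, Finset.mem_image] at hx
          rcases hx with rfl | ⟨q', hq', rfl⟩
          · exact .inl rfl
          · exact .inr ⟨q', Q.back_subset q hq hq', rfl⟩
      · intro x hx
        simp only [coneBack, hw, if_false, Finset.mem_image] at hx
        obtain ⟨w', hw', rfl⟩ := hx
        have h1 := G.back_subset w hw hw'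
        simp only [coneParent, hw, if_false]
        by_cases hp : G.parent w = G.root
        · rw [hp, G.back_root] at h1
          rw [hp, mem_coneBag_root]
          have h2 : w' = G.root := by simpa using h1
          exact .inr ⟨q, Finset.mem_insert_self _ _, by rw [h2]⟩
        · rw [mem_coneBag_inner hp]
          exact ⟨w', h1, rfl⟩
  pos_lt u v h := by
    rcases v with _ | ⟨⟨c, q⟩, w⟩
    · simp [coneBack] at h
    · by_cases hw : w = G.root
      · simp only [coneBack, hw, if_true, Finset.mem_insert, Finset.mem_image] at h
        rcases h with rfl | ⟨q', hq', rfl⟩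
        · simp only [conePos]; omega
        · have := Q.pos_lt q' q hq'
          simp only [conePos, hw]; omega
      · simp only [coneBack, hw, if_false, Finset.mem_image] at h
        obtain ⟨w', hw', rfl⟩ := h
        have := G.pos_lt w' w hw'
        simp only [conePos]; omega
  card_le v := by
    rcases v with _ | ⟨⟨c, q⟩, w⟩
    · simp [coneBack]
    · by_cases hw : w = G.root
      · simp only [coneBack, hw, if_true]
        exact (Finset.card_insert_le _ _).trans
          (Nat.add_le_add_right (Finset.card_image_le.trans (Q.card_le q)) 1)
      · simp only [coneBack, hw, if_false]
        exact Finset.card_image_le.trans (G.card_le w)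
  simple S hS := cone_simple hs S hS

variable [Finite U] [Finite W] {hs : 1 ≤ s}

theorem cone_adj_apex (c : Fin m) (q : U) :
    (cone hs m Q G).graph.Adj none (some ((c, q), G.root)) :=
  .inl (by simp [cone, coneBack])

theorem cone_adj_inner (c : Fin m) {q q' : U} (h : Q.graph.Adj q q') :
    (cone hs m Q G).graph.Adj (some ((c, q), G.root)) (some ((c, q'), G.root)) :=
  h.imp (fun h => by simp [cone, coneBack, h]) fun h => by simp [cone, coneBack, h]

theorem cone_adj_copy (c : Fin m) (q : U) {w w' : W} (h : G.graph.Adj w w') :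
    (cone hs m Q G).graph.Adj (some ((c, q), w)) (some ((c, q), w')) := by
  have key : ∀ {w w' : W}, w ∈ G.back w' →
      some ((c, q), w) ∈ (cone hs m Q G).back (some ((c, q), w')) := by
    intro w w' h
    have hw' : w' ≠ G.root := by
      rintro rfl
      rw [G.back_root] at h
      exact Finset.notMem_empty _ h
    simp [cone, coneBack, hw', h]
  exact h.imp key key

theorem exists_clique_cone (hm : 0 < m) {k : ℕ}
    (hC : ∃ C : Finset U, Q.graph.IsClique C ∧ C.card = k) :
    ∃ C : Finset (Option ((Fin m × U) × W)), (cone hs m Q G).graph.IsClique C ∧ C.card = k + 1 := by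
  obtain ⟨C, hC, rfl⟩ := hC
  let i : U → Option ((Fin m × U) × W) := fun q => some ((⟨0, hm⟩, q), G.root)
  have hi : Function.Injective i := fun a b h => by simpa [i] using h
  refine ⟨insert none (C.image i), ?_, ?_⟩
  · rw [Finset.coe_insert, SimpleGraph.isClique_insert_of_notMem (by simp [i])]
    refine ⟨?_, ?_⟩
    · intro x hx y hy hne
      rw [Finset.mem_coe, Finset.mem_image] at hx hy
      obtain ⟨a, ha, rfl⟩ := hx
      obtain ⟨b, hb, rfl⟩ := hy
      exact cone_adj_inner _ (hC ha hb fun e => hne (e ▸ rfl))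
    · intro y hy
      rw [Finset.mem_coe, Finset.mem_image] at hy
      obtain ⟨b, hb, rfl⟩ := hy
      exact cone_adj_apex _ _
  · rw [Finset.card_insert_of_notMem (by simp [i]), Finset.card_image_of_injective _ hi]

end Cone

end BagTree

namespace SimpleGraph

/-- Rankings restrict to subgraphs. -/
theorem IsRanking.comp {V W : Type*} {G : SimpleGraph V} {H : SimpleGraph W} {ℓ : ℕ} {φ : W → ℕ}
    (hφ : H.IsRanking ℓ φ) {f : V → W} (hf : Function.Injective f)
    (hadj : ∀ u v, G.Adj u v → H.Adj (f u) (f v)) : G.IsRanking ℓ (φ ∘ f) := by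
  intro u v p hp h1 h2
  let F : G →g H := ⟨f, hadj _ _⟩
  have h := hφ _ _ (p.map F) (hp.map hf) (by simpa using h1)
    (by simpa using h2)
  refine h.imp id ?_
  rintro ⟨w, hw, hlt⟩
  rw [Walk.support_map, List.mem_map] at hw
  obtain ⟨x, hx, rfl⟩ := hw
  exact ⟨x, hx, hlt⟩

/-- A ranking with all colours above `M` has a colour that is at least `M + χ_ℓ(G)`. -/
theorem IsRanking.exists_add_le {V : Type*} [Nonempty V] {G : SimpleGraph V} {ℓ M : ℕ}
    {φ : V → ℕ} (hφ : G.IsRanking ℓ φ) (hM : ∀ v, M < φ v) :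
    ∃ v, M + G.rankingNumber ℓ ≤ φ v := by
  by_contra! h
  have hle : G.rankingNumber ℓ ≤ G.rankingNumber ℓ - 1 := by
    refine Nat.sInf_le ⟨fun v => φ v - M, fun u v p hp h1 h2 => ?_, fun v => ?_⟩
    · have hu := hM u
      have hv := hM v
      rcases hφ u v p hp h1 h2 with hne | ⟨w, hw, hlt⟩
      · left
        show φ u - M ≠ φ v - M
        omega
      · refine .inr ⟨w, hw, ?_⟩
        show φ u - M < φ w - M
        omega
    · have h1 := h v
      have h2 := hM v
      show φ v - M ∈ _
      rw [Finset.mem_Icc]; omega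
  obtain ⟨v⟩ := ‹Nonempty V›
  have := h v
  have := hM v
  omega

theorem rankingNumber_le_card {V : Type*} [Fintype V] (G : SimpleGraph V) (ℓ : ℕ) :
    G.rankingNumber ℓ ≤ Fintype.card V := by
  have hlt := fun v => (Fintype.equivFin V v).2
  refine Nat.sInf_le ⟨fun v => (Fintype.equivFin V v : ℕ) + 1, ?_, fun v => ?_⟩
  · intro u v p hp h1 _
    left
    intro h
    have huv : u = v := (Fintype.equivFin V).injective (Fin.ext (Nat.succ_injective h))
    subst huv
    have : p.length = 0 := Walk.length_eq_zero_iff.2 (Walk.isPath_iff_nil.1 hp)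
    omega
  · exact Finset.mem_Icc.2 ⟨Nat.succ_pos _, hlt v⟩

theorem rankingNumber_pos {V : Type*} [Fintype V] [Nonempty V] (G : SimpleGraph V) (ℓ : ℕ) :
    0 < G.rankingNumber ℓ := by
  obtain ⟨φ, -, hφ⟩ := Nat.sInf_mem (exists_ranking G ℓ)
  obtain ⟨v⟩ := ‹Nonempty V›
  have := Finset.mem_Icc.1 (hφ v)
  exact lt_of_lt_of_le (by omega : 0 < φ v) this.2

end SimpleGraph

namespace BagTree

/-- If the root of `G` is forced to have a colour above `M` in every 2-ranking with colours
`1, …, k`, then the apex of the cone over `k + 1` copies of `Q` is forced to have a colour above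
`M + χ₂(Q)`: each copy of `Q` contains a vertex of colour at least `M + χ₂(Q)`, and two such vertices
in different copies have the same colour. -/
theorem lt_apex {U W : Type} [DecidableEq U] [DecidableEq W] [Finite U] [Finite W] {s k M : ℕ}
    (hs : 1 ≤ s) (Q : BagTree U s) (G : BagTree W (s + 1))
    (hG : ∀ φ : W → ℕ, G.graph.IsRanking 2 φ → (∀ v, φ v ∈ Finset.Icc 1 k) → M < φ G.root)
    {φ : Option ((Fin (k + 1) × U) × W) → ℕ} (hφ : (cone hs (k + 1) Q G).graph.IsRanking 2 φ)
    (hk : ∀ v, φ v ∈ Finset.Icc 1 k) : M + Q.graph.rankingNumber 2 < φ none := by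
  have : Nonempty U := ⟨Q.root⟩
  have hex : ∀ c : Fin (k + 1), ∃ q, M + Q.graph.rankingNumber 2 ≤ φ (some ((c, q), G.root)) := by
    intro c
    refine (hφ.comp (G := Q.graph) (f := fun q => some ((c, q), G.root))
      (fun a b h => by simpa using h) fun u v h => cone_adj_inner c h).exists_add_le fun q => ?_
    exact hG (φ ∘ fun w => some ((c, q), w)) (hφ.comp (fun a b h => by simpa using h)
      fun u v h => cone_adj_copy c q h) fun w => hk _
  choose q hq using hex
  obtain ⟨c, -, c', -, hne, heq⟩ := Finset.exists_ne_map_eq_of_card_lt_of_maps_to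
    (s := Finset.univ) (t := Finset.Icc 1 k) (by simp)
    (f := fun c => φ (some ((c, q c), G.root))) (fun c _ => hk _)
  let p : (cone hs (k + 1) Q G).graph.Walk (some ((c, q c), G.root)) (some ((c', q c'), G.root)) :=
    .cons (cone_adj_apex c (q c)).symm (.cons (cone_adj_apex c' (q c')) .nil)
  have hp : p.IsPath := by
    simp [p, SimpleGraph.Walk.cons_isPath_iff, hne]
  rcases hφ _ _ p hp (by simp [p]) (by simp [p]) with h | ⟨w, hw, hlt⟩
  · exact (h heq).elim
  · simp only [p, SimpleGraph.Walk.support_cons, SimpleGraph.Walk.support_nil, List.mem_cons,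
      List.not_mem_nil, or_false] at hw
    have heq' : φ (some ((c, q c), G.root)) = φ (some ((c', q c'), G.root)) := heq
    rcases hw with rfl | rfl | rfl
    · omega
    · exact (hq c).trans_lt hlt
    · omega

/-- Iterating the cone construction `h` times forces a colour above `h · χ₂(Q)`. -/
theorem exists_iterated_cone {U : Type} [DecidableEq U] [Fintype U] {s : ℕ} (hs : 1 ≤ s)
    (Q : BagTree U s) (k : ℕ) (hk : 1 ≤ k)
    (hC : ∃ C : Finset U, Q.graph.IsClique C ∧ C.card = s + 1) (h : ℕ) :
    ∃ (W : Type) (_ : DecidableEq W) (_ : Fintype W) (G : BagTree W (s + 1)),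
      2 ^ h ≤ Fintype.card W ∧ Fintype.card W ≤ ((k + 1) * Fintype.card U + 1) ^ h ∧
      (0 < h → ∃ C : Finset W, G.graph.IsClique C ∧ C.card = s + 1 + 1) ∧
      ∀ φ : W → ℕ, G.graph.IsRanking 2 φ → (∀ v, φ v ∈ Finset.Icc 1 k) →
        h * Q.graph.rankingNumber 2 < φ G.root := by
  induction h with
  | zero =>
    refine ⟨Unit, inferInstance, inferInstance, single _, by simp, by simp, by simp,
      fun φ _ hφ => ?_⟩
    have := Finset.mem_Icc.1 (hφ (single (s + 1)).root)
    omega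
  | succ h ih =>
    obtain ⟨W, _, _, G, h1, h2, -, h4⟩ := ih
    have hU : 1 ≤ Fintype.card U := Fintype.card_pos_iff.2 ⟨Q.root⟩
    have hcard : Fintype.card (Option ((Fin (k + 1) × U) × W)) =
        (k + 1) * Fintype.card U * Fintype.card W + 1 := by simp
    refine ⟨_, inferInstance, inferInstance, cone hs (k + 1) Q G, ?_, ?_,
      fun _ => exists_clique_cone (by omega) hC, fun φ hφ hφk => ?_⟩
    · rw [hcard, pow_succ, mul_comm]
      have : 2 ≤ (k + 1) * Fintype.card U := by nlinarith
      exact (Nat.mul_le_mul this h1).trans (Nat.le_succ _)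
    · rw [hcard, pow_succ]
      set b := (k + 1) * Fintype.card U
      have h5 : 1 ≤ (b + 1) ^ h := Nat.one_le_pow _ _ (by omega)
      have h6 := Nat.mul_le_mul_left b h2
      nlinarith
    · rw [Nat.succ_mul]
      exact lt_apex hs Q G h4 hφ hφk

end BagTree

/-! ### The lower bound -/

theorem eventually_iteratedLog_mono (i : ℕ) :
    ∀ᶠ x : ℝ in atTop, ∀ y, x ≤ y → iteratedLog i x ≤ iteratedLog i y := by
  induction i with
  | zero => exact .of_forall fun x y h => h
  | succ i ih =>
    filter_upwards [ih, (tendsto_iteratedLog i).eventually_gt_atTop 0] with x hx h0 y hxy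
    exact Real.log_le_log h0 (hx y hxy)

/-- The estimate behind the recursion: the number of cones over `m ^ 2 + 1` copies of a graph with
`m` vertices and 2-ranking number `χ` that force more than `m ^ 2` colours is `m ^ 2 / χ + 1`, which
gives at most `m ^ (4 * h)` vertices. -/
theorem exists_cone_bound (t : ℕ) (c : ℝ) (hc : 0 < c) : ∃ c' : ℝ, 0 < c' ∧ ∃ M : ℕ,
    ∀ m χ h n : ℕ, M ≤ m → 1 ≤ χ → χ ≤ m → h = m ^ 2 / χ + 1 →
      c * (Real.log m / iteratedLog (t + 1) m) ≤ χ → 2 ^ h ≤ n → n ≤ (m ^ 4) ^ h →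
      c' * (Real.log n / iteratedLog (t + 2) n) ≤ (m ^ 2 : ℕ) := by
  have hcast : Tendsto (fun m : ℕ => (m : ℝ)) atTop atTop := tendsto_natCast_atTop_atTop
  have hhalf : Tendsto (fun m : ℕ => (m : ℝ) / 2) atTop atTop :=
    hcast.atTop_div_const (by norm_num)
  obtain ⟨c₁, hc₁, hlow⟩ := exists_mul_iteratedLog_le (l := atTop) (x := fun m : ℕ => (m : ℝ))
    (y := fun m : ℕ => (m : ℝ) / 2) hcast (c := 1 / 2) (by norm_num) (by
      filter_upwards [(Real.tendsto_log_atTop.comp hcast).eventually_ge_atTop (2 * Real.log 2),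
        eventually_ge_atTop 1] with m hm hm1
      simp only [Function.comp_apply] at hm
      have : (m : ℝ) ≠ 0 := by positivity
      rw [Real.log_div this (by norm_num)]
      linarith) t
  have hmono := hhalf.eventually (eventually_iteratedLog_mono (t + 1))
  have hpos := ((tendsto_iteratedLog (t + 1)).comp hcast).eventually_gt_atTop 0
  obtain ⟨M, hM⟩ := eventually_atTop.1 (hlow.and (hmono.and (hpos.and (eventually_ge_atTop 2))))
  refine ⟨c * c₁ / 8, by positivity, M, fun m χ h n hm hχ hχm hh hcχ hn1 hn2 => ?_⟩
  obtain ⟨h1, h2, h3, h4⟩ := hM m hm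
  simp only [Function.comp_apply] at h3
  set J := iteratedLog (t + 1) (m : ℝ)
  have hm2 : (2 : ℝ) ≤ m := by exact_mod_cast h4
  have hχ1 : (1 : ℝ) ≤ χ := by exact_mod_cast hχ
  have hχm' : (χ : ℝ) ≤ m := by exact_mod_cast hχm
  have hlogm : 0 < Real.log m := Real.log_pos (by linarith)
  have hn0 : 0 < n := lt_of_lt_of_le (by positivity) hn1
  have hmh : m ≤ h := by
    have : m ≤ m ^ 2 / χ := by
      rw [Nat.le_div_iff_mul_le (by omega), sq]
      exact Nat.mul_le_mul_left m hχm
    omega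
  -- `log n ≥ m / 2`
  have hlogn : (m : ℝ) / 2 ≤ Real.log n := by
    have h5 : (h : ℝ) * Real.log 2 ≤ Real.log n := by
      rw [← Real.log_pow]
      apply Real.log_le_log (by positivity)
      exact_mod_cast hn1
    have h6 : (m : ℝ) ≤ h := by exact_mod_cast hmh
    have h7 := Real.log_two_gt_d9
    nlinarith
  have hI : c₁ * J ≤ iteratedLog (t + 2) n := by
    rw [← iteratedLog_log]
    exact h1.trans (h2 _ hlogn)
  -- `log n ≤ 8 (m ^ 2 / χ) log m`
  have hup : Real.log n ≤ 8 * ((m : ℝ) ^ 2 / χ) * Real.log m := by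
    have h5 : Real.log n ≤ h * (4 * Real.log m) := by
      have : Real.log n ≤ Real.log (((m : ℝ) ^ 4) ^ h) := by
        apply Real.log_le_log (by exact_mod_cast hn0)
        exact_mod_cast hn2
      rw [Real.log_pow, Real.log_pow] at this
      exact_mod_cast this
    have h6 : (h : ℝ) ≤ 2 * ((m : ℝ) ^ 2 / χ) := by
      have h7 : ((m ^ 2 / χ : ℕ) : ℝ) ≤ ((m ^ 2 : ℕ) : ℝ) / χ := Nat.cast_div_le
      have h8 : (1 : ℝ) ≤ (m : ℝ) ^ 2 / χ := by
        rw [one_le_div (by linarith)]; nlinarith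
      rw [hh]; push_cast at h7 ⊢
      linarith
    nlinarith
  have hJχ : Real.log m ≤ χ * J / c := by
    rw [← mul_div_assoc, div_le_iff₀ h3] at hcχ
    rw [le_div_iff₀ hc]
    linarith
  have hIpos : 0 < iteratedLog (t + 2) (n : ℝ) := (mul_pos hc₁ h3).trans_le hI
  rw [← mul_div_assoc, div_le_iff₀ hIpos]
  push_cast
  calc c * c₁ / 8 * Real.log n
      ≤ c * c₁ / 8 * (8 * ((m : ℝ) ^ 2 / χ) * (χ * J / c)) := by
        apply mul_le_mul_of_nonneg_left _ (by positivity)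
        exact hup.trans (mul_le_mul_of_nonneg_left hJχ (by positivity))
    _ = (m : ℝ) ^ 2 * (c₁ * J) := by
        field_simp
    _ ≤ _ := mul_le_mul_of_nonneg_left hI (by positivity)

namespace BagTree

/-- The lower bound for the graphs described by `BagTree`s. -/
theorem exists_le_rankingNumber (t : ℕ) : ∃ c : ℝ, 0 < c ∧ ∀ N : ℕ,
    ∃ (V : Type) (_ : DecidableEq V) (_ : Fintype V) (T : BagTree V (t + 1)),
      N ≤ Fintype.card V ∧ (∃ C : Finset V, T.graph.IsClique C ∧ C.card = t + 1 + 1) ∧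
      c * (Real.log (Fintype.card V) / iteratedLog (t + 1) (Fintype.card V)) ≤
        T.graph.rankingNumber 2 := by
  induction t with
  | zero =>
    -- the claimed bound is `log n / log n`, and the paths serve to have arbitrarily many vertices
    refine ⟨1, one_pos, fun N => ⟨Fin (N + 1 + 1), inferInstance, inferInstance, path (N + 1),
      by simp; omega, ⟨{0, 1}, ?_, by simp⟩, ?_⟩⟩
    · rw [Finset.coe_pair, SimpleGraph.isClique_pair]
      intro _
      left
      simp [path, pathParent]
    · have h1 : (1 : ℝ) ≤ (path (N + 1)).graph.rankingNumber 2 := by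
        exact_mod_cast SimpleGraph.rankingNumber_pos (path (N + 1)).graph 2
      refine le_trans ?_ h1
      rw [one_mul]
      exact div_self_le_one _
  | succ t ih =>
    obtain ⟨c, hc, hN⟩ := ih
    obtain ⟨c', hc', M, hM⟩ := exists_cone_bound t c hc
    refine ⟨c', hc', fun N => ?_⟩
    obtain ⟨U, _, _, Q, hUN, hC, hQ⟩ := hN (max (max M N) 2)
    set m := Fintype.card U with hm
    set χ := Q.graph.rankingNumber 2 with hχ
    have : Nonempty U := ⟨Q.root⟩
    have hm2 : 2 ≤ m := (le_max_right _ _).trans hUN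
    have hχ1 : 1 ≤ χ := SimpleGraph.rankingNumber_pos _ _
    have hχm : χ ≤ m := SimpleGraph.rankingNumber_le_card _ _
    set h := m ^ 2 / χ + 1 with hh
    obtain ⟨W, hWd, hW, G, h1, h2, h3, h4⟩ := exists_iterated_cone (by omega) Q (m ^ 2)
      (Nat.one_le_pow _ _ (by omega)) hC h
    refine ⟨W, hWd, hW, G, ?_, h3 (Nat.succ_pos _), ?_⟩
    · have h5 : m ≤ m ^ 2 / χ := by
        rw [Nat.le_div_iff_mul_le (by omega), sq]
        exact Nat.mul_le_mul_left m hχm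
      have h6 : N ≤ m := ((le_max_right _ _).trans (le_max_left _ _)).trans hUN
      exact (h6.trans (Nat.le_succ_of_le h5)).trans (Nat.lt_two_pow_self.le.trans h1)
    · have hcol : m ^ 2 ≤ G.graph.rankingNumber 2 := by
        by_contra! hlt
        obtain ⟨φ, hφ, hφk⟩ := Nat.sInf_mem (SimpleGraph.exists_ranking G.graph 2)
        have hk : ∀ v, φ v ∈ Finset.Icc 1 (m ^ 2) := fun v =>
          Finset.Icc_subset_Icc_right hlt.le (hφk v)
        have h5 : h * χ < φ G.root := h4 φ hφ hk
        have h6 := (Finset.mem_Icc.1 (hk G.root)).2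
        have h7 : m ^ 2 < m ^ 2 / χ * χ + χ := Nat.lt_div_mul_add hχ1
        rw [hh, Nat.succ_mul] at h5
        omega
      refine le_trans (hM m χ h _ (((le_max_left _ _).trans (le_max_left _ _)).trans hUN) hχ1 hχm
        hh hQ h1 (h2.trans (Nat.pow_le_pow_left ?_ h))) (by exact_mod_cast hcol)
      have h8 : m ^ 4 = m * m ^ 3 := by ring
      have h9 : m ^ 3 = m * m ^ 2 := by ring
      have h10 : m ^ 2 = m * m := by ring
      nlinarith [Nat.mul_le_mul_right (m ^ 3) hm2, Nat.mul_le_mul_right (m ^ 2) hm2,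
        Nat.mul_le_mul_right m hm2]

end BagTree

namespace SimpleGraph

variable {V W : Type*} {G : SimpleGraph V} {H : SimpleGraph W}

theorem HasSimpleTreeDecomposition.iso (e : G ≃g H) {t : ℕ} (h : G.HasSimpleTreeDecomposition t) :
    H.HasSimpleTreeDecomposition t := by
  obtain ⟨ι, hι, D, hw, hs⟩ := h
  have hmem : ∀ w x, w ∈ (D.bag x).map e.toEquiv.toEmbedding ↔ e.symm w ∈ D.bag x := by
    intro w x
    rw [Finset.mem_map_equiv]; rfl
  let D' : H.TreeDecomposition ι :=
    { tree := D.tree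
      isTree := D.isTree
      bag := fun x => (D.bag x).map e.toEquiv.toEmbedding
      connected := fun w => by
        rw [show {x | w ∈ (D.bag x).map e.toEquiv.toEmbedding} = {x | e.symm w ∈ D.bag x} from
          Set.ext fun x => hmem w x]
        exact D.connected (e.symm w)
      edge_mem := fun v w h => by
        obtain ⟨x, h1, h2⟩ := D.edge_mem _ _ (e.symm.map_adj_iff.2 h)
        exact ⟨x, (hmem _ _).2 h1, (hmem _ _).2 h2⟩ }
  refine ⟨ι, hι, D', ?_, fun S hS => ?_⟩
  · rw [← hw]; simp [TreeDecomposition.width, D']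
  · refine le_trans (le_of_eq ?_) (hs (S.map e.symm.toEquiv.toEmbedding) (by simpa using hS))
    congr 1
    refine Set.ext fun x => ⟨fun h v hv => ?_, fun h w hw => (hmem w x).2 (h ?_)⟩
    · rw [Finset.mem_map_equiv] at hv
      have : e.symm (e v) ∈ D.bag x := (hmem _ x).1 (h hv)
      rwa [RelIso.symm_apply_apply] at this
    · exact Finset.mem_map_of_mem _ hw

theorem simpleTreewidth_congr (e : G ≃g H) : G.simpleTreewidth = H.simpleTreewidth := by
  unfold simpleTreewidth
  congr 1
  ext t
  exact ⟨fun h => h.iso e, fun h => h.iso e.symm⟩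

theorem rankingNumber_le_of_iso [Fintype W] (e : G ≃g H) (ℓ : ℕ) :
    G.rankingNumber ℓ ≤ H.rankingNumber ℓ := by
  obtain ⟨φ, hφ, hk⟩ := Nat.sInf_mem (exists_ranking H ℓ)
  exact Nat.sInf_le ⟨φ ∘ e, hφ.comp e.injective fun u v h => e.map_adj_iff.2 h, fun v => hk _⟩

theorem infinite_le_rankingNumber (t : ℕ) (ht : 1 ≤ t) : ∃ c : ℝ, 0 < c ∧
    {n : ℕ | ∃ H : SimpleGraph (Fin n), H.simpleTreewidth = t ∧
      c * (Real.log n / iteratedLog t n) ≤ (H.rankingNumber 2 : ℝ)}.Infinite := by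
  obtain ⟨t, rfl⟩ : ∃ s, t = s + 1 := ⟨t - 1, by omega⟩
  obtain ⟨c, hc, hN⟩ := BagTree.exists_le_rankingNumber t
  refine ⟨c, hc, Set.infinite_of_forall_exists_gt fun N => ?_⟩
  obtain ⟨V, _, _, T, hcard, ⟨C, hC, hCt⟩, hT⟩ := hN (N + 1)
  let e := Iso.map (Fintype.equivFin V) T.graph
  refine ⟨Fintype.card V, ⟨_, (simpleTreewidth_congr e).symm.trans (T.simpleTreewidth_eq hC hCt),
    hT.trans ?_⟩, by omega⟩
  exact_mod_cast rankingNumber_le_of_iso e 2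

end SimpleGraph

theorem theorem2 :
    (∀ ℓ t : ℕ, 2 ≤ ℓ → 1 ≤ t →
      ∃ (C : ℝ) (N : ℕ), ∀ n : ℕ, N ≤ n →
        ∀ (V : Type*) [Fintype V] (H : SimpleGraph V), Fintype.card V = n →
          H.simpleTreewidth ≤ t →
            (H.rankingNumber ℓ : ℝ) ≤ C * (Real.log n / iteratedLog t n)) ∧
    (∀ t : ℕ, 1 ≤ t →
      ∃ c : ℝ, 0 < c ∧
        {n : ℕ | ∃ H : SimpleGraph (Fin n), H.simpleTreewidth = t ∧
          c * (Real.log n / iteratedLog t n) ≤ (H.rankingNumber 2 : ℝ)}.Infinite) := by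
  exact ⟨fun ℓ t _ ht => SimpleGraph.exists_rankingNumber_le ℓ t ht,
    fun t ht => SimpleGraph.infinite_le_rankingNumber t ht⟩
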